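/- Let $M$ be a smooth manifold, $\tau:TM\to M$ its tangent bundle, $T^\circ M$ the slit tangent bundle (nonzero tangent vectors), with natural coordinates $(x^i,\dot x^i)$, and let $S=\dot x^i\frac{\partial}{\partial x^i}+f^i\frac{\partial}{\partial \dot x^i}$ be a spray: a second-order vector field, smooth on $T^\circ M$, with $[\Delta,S]=S$, where $\Delta=\dot x^i\frac{\partial}{\partial\dot x^i}$. Let $\mathbf T=\dot x^i\frac{\partial}{\partial x^i}$ be the canonical vector field along $\tau$, and put $\Gamma^i_j=-\frac12\frac{\partial f^i}{\partial\dot x^j}$. The dynamical covariant derivative of a vector field $X$ along $\tau$ is $(\nabla X)^i=S(X^i)+\Gamma^i_jX^j$; the Jacobi endomorphism is $\Phi^i_j=-\frac{\partial f^i}{\partial x^j}-\Gamma^k_j\Gamma^i_k-S(\Gamma^i_j)$. For a one-form $\alpha$ and an endomorphism field $A$ along $\tau$ put $(\nabla\alpha)(X)=S(\alpha(X))-\alpha(\nabla X)$ and $(\nabla A)(X)=\nabla(A(X))-A(\nabla X)$. Write $X^V=X^i\frac{\partial}{\partial\dot x^i}$, $X^H=X^i\big(\frac{\partial}{\partial x^i}-\Gamma^j_i\frac{\partial}{\partial\dot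 x^j}\big)$, and $(d^Vg)(X)=X^V(g)$. Let $P$ be a smooth, positively $1$-homogeneous function on $T^\circ M$, let $\tilde S=S-2P\Delta$ be the projectively changed spray, with dynamical covariant derivative $\tilde\nabla$ and Jacobi endomorphism $\tilde\Phi$, and put $$a=P^2-S(P),\qquad b(X)=3X^H(P)-P\,X^V(P)-X^V(S(P)).$$ Let $U\subseteq T^\circ M$ be open (for instance $U=T^\circ M$), and suppose that $\Phi$ is diagonalizable over $\mathbb R$ at each point of $U$. Let $\tilde\lambda=\lambda+a$ be a smooth eigenfunction of $\tilde\Phi$ on $U$ that vanishes nowhere on $U$. Let $D_\lambda$ (respectively $\tilde D_{\tilde\lambda}$) be the set of smooth vector fields $X$ along $\tau$, over $U$, with $\Phi(X)=\lambda X$ (respectively $\tilde\Phi(X)=\tilde\lambda X$). Then $$[\tilde\nabla\tilde\Phi,\tilde\Phi](X)=0\ \text{ on } U\ \text{ for all } X\in\tilde D_{\tilde\lambda}$$ if and only if $$\Phi(\nabla X)-\lambda\nabla X=\Big(\nabla b+\Big(-\frac{S(\lambda+a)}{\lambda+a}+P\Big)b+(\lambda+a)\,d^VP\Big)(X)\,\mathbf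 T\ \text{ on } U\ \text{ for all } X\in D_\lambda .$$ -/

import Mathlib

open scoped Manifold ContDiff

noncomputable section

namespace SprayGeom

section

variable {E : Type*} [NormedAddCommGroup E] [NormedSpace ℝ E]
  {M : Type*} [TopologicalSpace M] [ChartedSpace E M] [IsManifold 𝓘(ℝ, E) ∞ M]
  {F : Type*} [NormedAddCommGroup F] [NormedSpace ℝ F]

/-- The total space `TM` of the tangent bundle of a manifold `M` modelled on `E`. -/
abbrev TB (E : Type*) [NormedAddCommGroup E] [NormedSpace ℝ E]
    (M : Type*) [TopologicalSpace M] [ChartedSpace E M] [IsManifold 𝓘(ℝ, E) ∞ M] : Type _ :=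
  TangentBundle 𝓘(ℝ, E) M

/-- The slit tangent bundle: the nonzero tangent vectors. -/
def slit (E : Type*) [NormedAddCommGroup E] [NormedSpace ℝ E]
    (M : Type*) [TopologicalSpace M] [ChartedSpace E M] [IsManifold 𝓘(ℝ, E) ∞ M] :
    Set (TB E M) :=
  {v | v.snd ≠ 0}

/-- The tangent space of `M` at the base point of `v`. In Mathlib its elements are written in
components with respect to the preferred chart of `M` at that point. -/
abbrev VSp (v : TB E M) : Type _ := TangentSpace 𝓘(ℝ, E) v.proj

/-- The tangent space of `TM` at `v`. In Mathlib its elements are the pairs of components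
`(ξ, η) = (ξ^i, η^i)`, standing for `ξ^i ∂/∂x^i + η^i ∂/∂ẋ^i`, in the natural chart of `TM` induced
by the preferred chart of `M` at the base point of `v`. -/
abbrev TSp (v : TB E M) : Type _ := TangentSpace 𝓘(ℝ, E).tangent v

/-- Vector fields along the projection `τ : TM → M`. -/
abbrev FieldAlong (E : Type*) [NormedAddCommGroup E] [NormedSpace ℝ E]
    (M : Type*) [TopologicalSpace M] [ChartedSpace E M] [IsManifold 𝓘(ℝ, E) ∞ M] : Type _ :=
  (v : TB E M) → VSp v

/-- Vector fields on `TM`. -/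
abbrev FieldOn (E : Type*) [NormedAddCommGroup E] [NormedSpace ℝ E]
    (M : Type*) [TopologicalSpace M] [ChartedSpace E M] [IsManifold 𝓘(ℝ, E) ∞ M] : Type _ :=
  (v : TB E M) → TSp v

/-- Type (1,1) tensor fields along `τ`. -/
abbrev EndAlong (E : Type*) [NormedAddCommGroup E] [NormedSpace ℝ E]
    (M : Type*) [TopologicalSpace M] [ChartedSpace E M] [IsManifold 𝓘(ℝ, E) ∞ M] : Type _ :=
  (v : TB E M) → VSp v →L[ℝ] VSp v

/-- One-forms along `τ`. -/
abbrev FormAlong (E : Type*) [NormedAddCommGroup E] [NormedSpace ℝ E]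
    (M : Type*) [TopologicalSpace M] [ChartedSpace E M] [IsManifold 𝓘(ℝ, E) ∞ M] : Type _ :=
  (v : TB E M) → VSp v →L[ℝ] ℝ

/-- Smoothness on `U ⊆ TM` of a vector field along `τ`, i.e. of the map `X : TM → TM`. -/
def SmoothAlong (U : Set (TB E M)) (X : FieldAlong E M) : Prop :=
  ContMDiffOn 𝓘(ℝ, E).tangent 𝓘(ℝ, E).tangent ∞ (fun v => (⟨v.proj, X v⟩ : TB E M)) U

/-- The canonical vector field `T` along `τ`, `T(v) = v`. -/
def T : FieldAlong E M := fun v => v.snd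

/-- The differential at `v` of a function on `TM` with values in a vector space. -/
def dAt (g : TB E M → F) (v : TB E M) : TSp v →L[ℝ] F :=
  mfderiv 𝓘(ℝ, E).tangent 𝓘(ℝ, F) g v

/-- The derivative `S(g)` of a function `g` on `TM` along a vector field `S` on `TM`. -/
def lieD (S : FieldOn E M) (g : TB E M → F) : TB E M → F := fun v => dAt g v (S v)

/-- The vertical lift at `v`: `X^i ∂/∂x^i ↦ X^i ∂/∂ẋ^i`. -/
def vlift (v : TB E M) : VSp v →L[ℝ] TSp v := ContinuousLinearMap.inr ℝ E E

/-- The Liouville vector field `Δ`, the vertical lift of `T`. -/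
def liouville : FieldOn E M := fun v => vlift v (T v)

/-- A spray: a smooth second-order vector field `S` on the slit tangent bundle (`dτ(S(v)) = v`)
such that `[Δ, S] = S`. -/
structure IsSpray (S : FieldOn E M) : Prop where
  smooth : ContMDiffOn 𝓘(ℝ, E).tangent 𝓘(ℝ, E).tangent.tangent ∞
    (fun v => (⟨v, S v⟩ : TangentBundle 𝓘(ℝ, E).tangent (TB E M))) (slit E M)
  sode : ∀ v ∈ slit E M, mfderiv 𝓘(ℝ, E).tangent 𝓘(ℝ, E)
    (fun w : TB E M => w.proj) v (S v) = v.snd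
  homog : ∀ v ∈ slit E M,
    VectorField.mlieBracket 𝓘(ℝ, E).tangent liouville S v = S v

/-! ### Natural coordinates

The preferred chart of `M` at `q` has the coordinates `x`; it induces the natural coordinates
`(x, ẋ)` on the part of `TM` above its domain. -/

/-- The fibre coordinates `ẋ = (ẋ^1, …, ẋ^n)` of the natural chart given by `q`. -/
def fibreCoord (q : M) (v : TB E M) : E :=
  (extChartAt 𝓘(ℝ, E).tangent (⟨q, 0⟩ : TB E M) v).2

/-- The derivative of `g` at `v` in the coordinates `(x, ẋ)` of the natural chart given by `q`. -/
def coordDeriv (q : M) (g : TB E M → F) (v : TB E M) : E × E →L[ℝ] F :=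
  fderiv ℝ (g ∘ (extChartAt 𝓘(ℝ, E).tangent (⟨q, 0⟩ : TB E M)).symm)
    (extChartAt 𝓘(ℝ, E).tangent (⟨q, 0⟩ : TB E M) v)

/-- `∂g/∂x` at `v` (all partial derivatives together, as a linear map). -/
def partialX (q : M) (g : TB E M → F) (v : TB E M) : E →L[ℝ] F :=
  (coordDeriv q g v).comp (ContinuousLinearMap.inl ℝ E E)

/-- `∂g/∂ẋ` at `v`. -/
def partialV (q : M) (g : TB E M → F) (v : TB E M) : E →L[ℝ] F :=
  (coordDeriv q g v).comp (ContinuousLinearMap.inr ℝ E E)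

/-- The force coefficients `f^i = S(ẋ^i)` of `S = ẋ^i ∂/∂x^i + f^i ∂/∂ẋ^i`. -/
def force (S : FieldOn E M) (q : M) : TB E M → E := lieD S (fibreCoord q)

/-- The connection coefficients `Γ^i_j = -(1/2) ∂f^i/∂ẋ^j`, as the linear map
`u^j ↦ Γ^i_j u^j`. -/
def conn (S : FieldOn E M) (q : M) (v : TB E M) : E →L[ℝ] E :=
  -((1 / 2 : ℝ) • partialV q (force S q) v)

/-- The dynamical covariant derivative on vector fields along `τ`:
`(∇X)^i = S(X^i) + Γ^i_j X^j`. The value at `v` is computed in the natural chart given by the base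
point of `v`, in which vectors at that base point are their own components. -/
def nabla (S : FieldOn E M) (X : FieldAlong E M) : FieldAlong E M := fun v =>
  lieD S (fun w => fibreCoord v.proj (⟨w.proj, X w⟩ : TB E M)) v + conn S v.proj v (X v)

/-- The Jacobi endomorphism `Φ^i_j = -∂f^i/∂x^j - Γ^k_j Γ^i_k - S(Γ^i_j)`. -/
def jacobi (S : FieldOn E M) : EndAlong E M := fun v =>
  (-partialX v.proj (force S v.proj) v
    - (conn S v.proj v).comp (conn S v.proj v)
    - lieD S (conn S v.proj) v : E →L[ℝ] E)

/-- The horizontal lift at `v`: `X^i ∂/∂x^i ↦ X^i (∂/∂x^i - Γ^j_i ∂/∂ẋ^j)`. -/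
def hlift (S : FieldOn E M) (v : TB E M) : VSp v →L[ℝ] TSp v :=
  ContinuousLinearMap.prod (ContinuousLinearMap.id ℝ E) (-conn S v.proj v)

/-! ### Tensors along the projection -/

/-- An endomorphism field applied to a vector field along `τ`. -/
def EndAlong.app (A : EndAlong E M) (X : FieldAlong E M) : FieldAlong E M := fun v => A v (X v)

/-- `(∇A)(X) = ∇(A(X)) - A(∇X)`. -/
def nablaEnd (S : FieldOn E M) (A : EndAlong E M) (X : FieldAlong E M) : FieldAlong E M :=
  nabla S (EndAlong.app A X) - EndAlong.app A (nabla S X)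

/-- `[∇Φ, Φ](X) = (∇Φ)(Φ(X)) - Φ((∇Φ)(X))`, where `Φ` is the Jacobi endomorphism of `S`. -/
def bracketNablaJacobi (S : FieldOn E M) (X : FieldAlong E M) : FieldAlong E M :=
  nablaEnd S (jacobi S) (EndAlong.app (jacobi S) X)
    - EndAlong.app (jacobi S) (nablaEnd S (jacobi S) X)

/-- `(∇α)(X) = S(α(X)) - α(∇X)` for a one-form `α` along `τ`. -/
def nablaForm (S : FieldOn E M) (α : FormAlong E M) (X : FieldAlong E M) : TB E M → ℝ := fun v =>
  lieD S (fun w => α w (X w)) v - α v (nabla S X v)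

/-- The vertical differential: `(d^V g)(X) = X^V(g)`. -/
def dV (g : TB E M → ℝ) : FormAlong E M := fun v => (dAt g v).comp (vlift v)

/-- The horizontal differential: `X ↦ X^H(g)`. -/
def dH (S : FieldOn E M) (g : TB E M → ℝ) : FormAlong E M := fun v => (dAt g v).comp (hlift S v)

/-- `Φ` is diagonalizable (over `ℝ`) at each point of `U`. -/
def DiagonalizableOn (U : Set (TB E M)) (A : EndAlong E M) : Prop :=
  ∀ v ∈ U, ⨆ μ : ℝ, Module.End.eigenspace (A v : VSp v →ₗ[ℝ] VSp v) μ = ⊤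

/-- `lam` is a smooth eigenfunction of `A` on `U`. -/
structure IsEigenfunctionOn (U : Set (TB E M)) (A : EndAlong E M) (lam : TB E M → ℝ) : Prop where
  smooth : ContMDiffOn 𝓘(ℝ, E).tangent 𝓘(ℝ, ℝ) ∞ lam U
  eigen : ∀ v ∈ U, Module.End.HasEigenvalue (A v : VSp v →ₗ[ℝ] VSp v) (lam v)

/-- The eigendistribution of `A` for `lam` over `U`: the smooth vector fields `X` along `τ` with
`A(X) = lam X` on `U`. -/
def eigenDist (U : Set (TB E M)) (A : EndAlong E M) (lam : TB E M → ℝ) : Set (FieldAlong E M) :=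
  {X | SmoothAlong U X ∧ ∀ v ∈ U, A v (X v) = lam v • X v}

/-! ### Projective changes -/

/-- A projective factor: a function, smooth on the slit tangent bundle and positively homogeneous
of degree one there. -/
structure IsProjectiveFactor (P : TB E M → ℝ) : Prop where
  smooth : ContMDiffOn 𝓘(ℝ, E).tangent 𝓘(ℝ, ℝ) ∞ P (slit E M)
  homog : ∀ v ∈ slit E M, ∀ c : ℝ, 0 < c → P ⟨v.proj, c • v.snd⟩ = c * P v

/-- The projectively changed spray `S - 2PΔ`. -/
def projChange (S : FieldOn E M) (P : TB E M → ℝ) : FieldOn E M := fun v =>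
  S v - (2 * P v) • liouville v

/-- `a = P² - S(P)`. -/
def aFun (S : FieldOn E M) (P : TB E M → ℝ) : TB E M → ℝ := fun v => P v ^ 2 - lieD S P v

/-- `b(X) = 3 X^H(P) - P X^V(P) - X^V(S(P))`. -/
def bForm (S : FieldOn E M) (P : TB E M → ℝ) : FormAlong E M := fun v =>
  (3 : ℝ) • dH S P v - P v • dV P v - dV (lieD S P) v

end

end SprayGeom

end

noncomputable section

open scoped Topology
open Filter

namespace SprayGeom

/-! ### Sprays, `∇` and `Φ` in one chart, their projective changes and coordinate changes. -/

section Euclidean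

variable {E : Type*} [NormedAddCommGroup E] [NormedSpace ℝ E]
  {V : Type*} [NormedAddCommGroup V] [NormedSpace ℝ V]

/-! Write `λ̃ = λ + a`. A projective change gives `Φ̃ = Φ + a·id + b ⊗ T` (`jacobiE_changeE`) and
`∇̃X = ∇X - 2P ∂_Δ X + P X + d^VP(X) T`, where `∂_Δ` differentiates components along `Δ`
(`nablaE_changeE`). Homogeneity gives `Φ(T) = Φ̃(T) = 0` and `∇T = 0`.

If `Φ̃(X) = λ̃X`, then the Leibniz rule yields `[∇̃Φ̃, Φ̃](X) = (Φ̃ - λ̃)²(∇̃X)`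
(`bracketModel_eq`). The endomorphism `Φ̃` need not be diagonalizable, but diagonalizability of `Φ`
rules out nontrivial generalized eigenvectors of `Φ̃` for nonzero eigenvalues
(`eq_zero_of_perturbed_eigenvector`). Zero must be excluded: for `Φ = 0`, `a = 0`, `b(T) = 0`, `b ≠
0` the endomorphism `b ⊗ T` is nilpotent and nonzero. So the bracket vanishes on `X` exactly when
the defect `(Φ̃ - λ̃)(∇̃X)` does. The term `∂_Δ X` drops out of the defect: differentiating `Φ̃(X) =
λ̃X` along `Δ` with `Φ̃` of degree two shows that it is a generalized eigenvector, hence an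
eigenvector.

The shift `X ↦ X + (b(X)/λ̃) T` sends `D_λ` into `D̃_λ̃`, and the defect of the shifted field is the
difference of the two sides of the asserted equation (`defect_shift`). This gives one implication at
once.

For the other, not every field in `D̃_λ̃` is visibly a shift: undoing the shift divides by `λ`,
which may vanish. But if `X` is in `D̃_λ̃`, then `Φ(X)` is in `D_λ` and its shift is `λX`, so the
defect of `X` vanishes where `λ ≠ 0` and, by continuity, on the closure of that set. Elsewhere a
bump function `g` supported where `λ = 0` puts `gX` in `D_λ` with `b(gX) = 0`, so `gX` is its own
shift (`defect_eq_zero_of_shift`).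

Since `∇` and `Φ` are defined pointwise in a chart depending on the point, their smoothness and any
second differentiation need coordinate independence, which is read off from the bracket of `S` with
`X^H` (`bracket_hliftE`). -/

/-- The second-order vector field `ẋ ∂/∂x + f ∂/∂ẋ` on `E × E`. -/
def sodeE (f : E × E → E) (z : E × E) : E × E := (z.2, f z)

/-- The connection coefficients of `sodeE f`. -/
def connE (f : E × E → E) (z : E × E) : E →L[ℝ] E :=
  -((1 / 2 : ℝ) • (fderiv ℝ f z).comp (ContinuousLinearMap.inr ℝ E E))

/-- The dynamical covariant derivative of `sodeE f`. -/
def nablaE (f X : E × E → E) (z : E × E) : E :=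
  fderiv ℝ X z (sodeE f z) + connE f z (X z)

/-- The Jacobi endomorphism of `sodeE f`. -/
def jacobiE (f : E × E → E) (z : E × E) : E →L[ℝ] E :=
  -(fderiv ℝ f z).comp (ContinuousLinearMap.inl ℝ E E)
    - (connE f z).comp (connE f z) - fderiv ℝ (connE f) z (sodeE f z)

/-- The force coefficients of the projective change of `sodeE f` by the factor `p`. -/
def changeE (f : E × E → E) (p : E × E → ℝ) (z : E × E) : E := f z - (2 * p z) • z.2

/-- The coordinate form of `bForm`. -/
def bFormE (f : E × E → E) (p : E × E → ℝ) (z : E × E) (u : E) : ℝ :=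
  3 * fderiv ℝ p z (u, -connE f z u) - p z * fderiv ℝ p z (0, u)
    - fderiv ℝ (fun z' => fderiv ℝ p z' (sodeE f z')) z (0, u)

lemma connE_apply (f : E × E → E) (z : E × E) (u : E) :
    connE f z u = -((1 / 2 : ℝ) • fderiv ℝ f z (0, u)) := by
  simp [connE]

lemma fderiv_vert (f : E × E → E) (z : E × E) (u : E) :
    fderiv ℝ f z (0, u) = -((2 : ℝ) • connE f z u) := by
  rw [connE_apply, smul_neg, smul_smul]; norm_num

lemma fderiv_split (f : E × E → V) (z : E × E) (u w : E) :
    fderiv ℝ f z (u, w) = fderiv ℝ f z (u, 0) + fderiv ℝ f z (0, w) := by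
  rw [← map_add]; simp

lemma jacobiE_apply (f : E × E → E) (z : E × E) (u : E) :
    jacobiE f z u = -fderiv ℝ f z (u, 0) - connE f z (connE f z u)
      - fderiv ℝ (connE f) z (sodeE f z) u := by
  simp [jacobiE]

lemma contDiffAt_fderiv {f : E × E → V} {z : E × E} (hf : ContDiffAt ℝ ∞ f z) :
    ContDiffAt ℝ ∞ (fderiv ℝ f) z := hf.fderiv_right (by simp)

lemma contDiffAt_sodeE {f : E × E → E} {z : E × E} (hf : ContDiffAt ℝ ∞ f z) :
    ContDiffAt ℝ ∞ (sodeE f) z := contDiffAt_snd.prodMk hf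

lemma contDiffAt_connE {f : E × E → E} {z : E × E} (hf : ContDiffAt ℝ ∞ f z) :
    ContDiffAt ℝ ∞ (connE f) z := by
  unfold connE
  exact (((contDiffAt_fderiv hf).clm_comp contDiffAt_const).const_smul _).neg

lemma contDiffAt_nablaE {f X : E × E → E} {z : E × E} (hf : ContDiffAt ℝ ∞ f z)
    (hX : ContDiffAt ℝ ∞ X z) : ContDiffAt ℝ ∞ (nablaE f X) z := by
  unfold nablaE
  exact ((contDiffAt_fderiv hX).clm_apply (contDiffAt_sodeE hf)).add
    ((contDiffAt_connE hf).clm_apply hX)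

lemma contDiffAt_jacobiE {f : E × E → E} {z : E × E} (hf : ContDiffAt ℝ ∞ f z) :
    ContDiffAt ℝ ∞ (jacobiE f) z := by
  unfold jacobiE
  exact (((contDiffAt_fderiv hf).clm_comp contDiffAt_const).neg.sub
    ((contDiffAt_connE hf).clm_comp (contDiffAt_connE hf))).sub
    ((contDiffAt_fderiv (contDiffAt_connE hf)).clm_apply (contDiffAt_sodeE hf))

lemma differentiableAt_of_smooth {f : E × E → V} {z : E × E} (hf : ContDiffAt ℝ ∞ f z) :
    DifferentiableAt ℝ f z := hf.differentiableAt (by simp)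

lemma eventually_differentiableAt {f : E × E → V} {z : E × E} (hf : ContDiffAt ℝ ∞ f z) :
    ∀ᶠ z' in 𝓝 z, DifferentiableAt ℝ f z' :=
  ((hf.of_le (m := 1) (by simp)).eventually (by simp)).mono
    fun _ h => h.differentiableAt (by simp)

lemma symm_snd {f : E × E → V} {z : E × E} (hf : ContDiffAt ℝ ∞ f z) (ξ η : E × E) :
    fderiv ℝ (fderiv ℝ f) z ξ η = fderiv ℝ (fderiv ℝ f) z η ξ :=
  (hf.isSymmSndFDerivAt (by
    rw [minSmoothness_of_isRCLikeNormedField]; exact WithTop.coe_le_coe.2 le_top)) ξ η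

/-- Leibniz rule for the derivative of `f` along a vector field. -/
lemma fderiv_along {f : E × E → V} {W : E × E → E × E} {z : E × E} (hf : ContDiffAt ℝ ∞ f z)
    (hW : DifferentiableAt ℝ W z) (ξ : E × E) :
    fderiv ℝ (fun z' => fderiv ℝ f z' (W z')) z ξ
      = fderiv ℝ (fderiv ℝ f) z ξ (W z) + fderiv ℝ f z (fderiv ℝ W z ξ) := by
  rw [fderiv_clm_apply (differentiableAt_of_smooth (contDiffAt_fderiv hf)) hW]
  simp [add_comm]

lemma hasFDerivAt_vert (z : E × E) : HasFDerivAt (fun z : E × E => ((0 : E), z.2))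
    ((0 : E × E →L[ℝ] E).prod (ContinuousLinearMap.snd ℝ E E)) z :=
  (hasFDerivAt_const _ _).prodMk hasFDerivAt_snd

lemma fderiv_sodeE {f : E × E → E} {z : E × E} (hf : DifferentiableAt ℝ f z) (ξ : E × E) :
    fderiv ℝ (sodeE f) z ξ = (ξ.2, fderiv ℝ f z ξ) := by
  have : HasFDerivAt (sodeE f) ((ContinuousLinearMap.snd ℝ E E).prod (fderiv ℝ f z)) z :=
    hasFDerivAt_snd.prodMk hf.hasFDerivAt
  rw [this.fderiv]; rfl

/-- Differentiating Euler's relation. -/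
lemma fderiv_fderiv_euler {g : E × E → V} {z : E × E} (k : ℝ) (hg : ContDiffAt ℝ ∞ g z)
    (hh : ∀ᶠ z' in 𝓝 z, fderiv ℝ g z' (0, z'.2) = k • g z') (ξ : E × E) :
    fderiv ℝ (fderiv ℝ g) z ξ (0, z.2) + fderiv ℝ g z (0, ξ.2) = k • fderiv ℝ g z ξ := by
  have h1 := fderiv_along hg (hasFDerivAt_vert z).differentiableAt ξ
  rw [(hasFDerivAt_vert z).fderiv] at h1
  have h2 : fderiv ℝ (fun z' => fderiv ℝ g z' (0, z'.2)) z ξ = k • fderiv ℝ g z ξ := by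
    rw [EventuallyEq.fderiv_eq (f₁ := fun z' => fderiv ℝ g z' (0, z'.2)) hh,
      fderiv_fun_const_smul (differentiableAt_of_smooth hg)]; rfl
  rw [← h2, h1]; rfl

/-- The derivative along a quadratic second-order field raises the degree by one. -/
lemma euler_along {f : E × E → E} {g : E × E → V} {z : E × E} (k : ℝ)
    (hf : ContDiffAt ℝ ∞ f z) (hfh : fderiv ℝ f z (0, z.2) = (2 : ℝ) • f z)
    (hg : ContDiffAt ℝ ∞ g z) (hh : ∀ᶠ z' in 𝓝 z, fderiv ℝ g z' (0, z'.2) = k • g z') :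
    fderiv ℝ (fun z' => fderiv ℝ g z' (sodeE f z')) z (0, z.2)
      = (k + 1) • fderiv ℝ g z (sodeE f z) := by
  rw [fderiv_along hg (differentiableAt_of_smooth (contDiffAt_sodeE hf)),
    fderiv_sodeE (differentiableAt_of_smooth hf), symm_snd hg, hfh]
  have h := fderiv_fderiv_euler k hg hh (sodeE f z)
  -- `(ẋ, 2f)` is `S` plus the vertical lift of `f`; that extra term cancels the correction in the
  -- differentiated Euler relation `h4`.
  have h3 : fderiv ℝ g z (z.2, (2 : ℝ) • f z)
      = fderiv ℝ g z (sodeE f z) + fderiv ℝ g z (0, f z) := by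
    rw [← map_add, sodeE, Prod.mk_add_mk, add_zero, two_smul]
  have h4 : fderiv ℝ (fderiv ℝ g) z (sodeE f z) (0, z.2)
      = k • fderiv ℝ g z (sodeE f z) - fderiv ℝ g z (0, f z) := by
    rw [← h, sodeE]; simp
  simp only [] at h3 ⊢
  rw [h3, h4, add_smul, one_smul]; abel

/-- The infinitesimal form of two-homogeneity near `z`. -/
def QuadraticAt (f : E × E → E) (z : E × E) : Prop :=
  ∀ᶠ z' in 𝓝 z, fderiv ℝ f z' (0, z'.2) = (2 : ℝ) • f z'

lemma QuadraticAt.connE_snd {f : E × E → E} {z : E × E} (h : QuadraticAt f z) :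
    connE f z z.2 = -f z := by
  rw [connE_apply, h.self_of_nhds, smul_smul]; norm_num

lemma fderiv_connE {f : E × E → E} {z : E × E} (hf : ContDiffAt ℝ ∞ f z) (ξ : E × E) (u : E) :
    fderiv ℝ (connE f) z ξ u = -((1 / 2 : ℝ) • fderiv ℝ (fderiv ℝ f) z ξ (0, u)) := by
  have h := (((differentiableAt_of_smooth (contDiffAt_fderiv hf)).hasFDerivAt.clm_comp
    (hasFDerivAt_const (ContinuousLinearMap.inr ℝ E E) z)).const_smul (1 / 2 : ℝ)).neg
  have h' : HasFDerivAt (connE f) _ z := h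
  rw [h'.fderiv]
  simp

/-- `Γ` is a vertical derivative of a function of degree two, hence has degree one. -/
lemma QuadraticAt.fderiv_connE_vert {f : E × E → E} {z : E × E} (hf : ContDiffAt ℝ ∞ f z)
    (h : QuadraticAt f z) : fderiv ℝ (connE f) z (0, z.2) = connE f z := by
  ext u
  have := fderiv_fderiv_euler 2 hf h (0, u)
  rw [fderiv_connE hf, symm_snd hf, connE_apply]
  rw [two_smul, add_left_inj] at this
  rw [this]

lemma QuadraticAt.eventually {f : E × E → E} {z : E × E} (h : QuadraticAt f z) :
    ∀ᶠ z' in 𝓝 z, QuadraticAt f z' := eventually_eventually_nhds.2 h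

/-- Differentiating `Γ(ẋ) = -f` along `S` gives `S(Γ)ẋ + Γf = -S(f)`, and `S(f) = (∂f/∂x)ẋ - 2Γf`;
the terms of `Φ(ẋ)` then cancel. -/
lemma QuadraticAt.jacobiE_snd {f : E × E → E} {z : E × E} (hf : ContDiffAt ℝ ∞ f z)
    (h : QuadraticAt f z) : jacobiE f z z.2 = 0 := by
  have h1 : (fun z' : E × E => connE f z' z'.2) =ᶠ[𝓝 z] fun z' => -f z' :=
    h.eventually.mono fun z' hz' => hz'.connE_snd
  have h2 := congrArg (fun L : E × E →L[ℝ] E => L (sodeE f z)) h1.fderiv_eq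
  rw [fderiv_clm_apply (differentiableAt_of_smooth (contDiffAt_connE hf)) differentiableAt_snd,
    fderiv_snd, fderiv_fun_neg] at h2
  simp only [add_apply, ContinuousLinearMap.comp_apply,
    ContinuousLinearMap.flip_apply, neg_apply,
    ContinuousLinearMap.coe_snd'] at h2
  have h3 : fderiv ℝ f z (sodeE f z) = fderiv ℝ f z (z.2, 0) - (2 : ℝ) • connE f z (f z) := by
    rw [sodeE, fderiv_split, fderiv_vert, sub_eq_add_neg]
  have h4 : (sodeE f z).2 = f z := rfl
  rw [h3, h4] at h2
  rw [jacobiE_apply, h.connE_snd, eq_sub_of_add_eq' h2, map_neg, two_smul]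
  abel

lemma QuadraticAt.nablaE_snd {f : E × E → E} {z : E × E} (h : QuadraticAt f z) :
    nablaE f Prod.snd z = 0 := by
  rw [nablaE, fderiv_snd, h.connE_snd]; simp [sodeE]

/-- All three terms of `Φ` have degree two: `∂f/∂x` inherits it from `f`, `Γ ∘ Γ` has it because `Γ`
has degree one, and `S` raises the degree of `Γ` by one (`euler_along`). -/
lemma QuadraticAt.fderiv_jacobiE_vert {f : E × E → E} {z : E × E} (hf : ContDiffAt ℝ ∞ f z)
    (h : QuadraticAt f z) (hev : ∀ᶠ z' in 𝓝 z, ContDiffAt ℝ ∞ f z') :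
    fderiv ℝ (jacobiE f) z (0, z.2) = (2 : ℝ) • jacobiE f z := by
  have hD := differentiableAt_of_smooth (contDiffAt_fderiv hf)
  have hG := differentiableAt_of_smooth (contDiffAt_connE hf)
  have hGS := differentiableAt_of_smooth
    ((contDiffAt_fderiv (contDiffAt_connE hf)).clm_apply (contDiffAt_sodeE hf))
  have key := ((hD.hasFDerivAt.clm_comp (hasFDerivAt_const (ContinuousLinearMap.inl ℝ E E) z)).neg.sub
    (hG.hasFDerivAt.clm_comp hG.hasFDerivAt)).sub hGS.hasFDerivAt
  have key' : HasFDerivAt (jacobiE f) _ z := key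
  have e1 : fderiv ℝ (fun z' => fderiv ℝ (connE f) z' (sodeE f z')) z (0, z.2)
      = (2 : ℝ) • fderiv ℝ (connE f) z (sodeE f z) := by
    rw [euler_along 1 hf h.self_of_nhds (contDiffAt_connE hf)]
    · norm_num
    · filter_upwards [h.eventually, hev] with z' h1 h2
      rw [h1.fderiv_connE_vert h2, one_smul]
  rw [key'.fderiv]
  ext u
  have e2 : fderiv ℝ (fderiv ℝ f) z (0, z.2) (u, 0) = (2 : ℝ) • fderiv ℝ f z (u, 0) := by
    rw [symm_snd hf, ← fderiv_fderiv_euler 2 hf h (u, 0)]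
    simp only [Prod.mk_zero_zero, map_zero, add_zero]
  simp only [sub_apply, neg_apply, e1,
    add_apply, ContinuousLinearMap.comp_apply,
    ContinuousLinearMap.compL_apply, ContinuousLinearMap.flip_apply,
    h.fderiv_connE_vert hf, smul_apply, jacobiE_apply,
    ContinuousLinearMap.inl_apply, zero_apply, e2,
    ContinuousLinearMap.comp_zero]
  simp only [two_smul, zero_add]
  abel

/-! ### Projective changes -/

lemma contDiffAt_changeE {f : E × E → E} {p : E × E → ℝ} {z : E × E} (hf : ContDiffAt ℝ ∞ f z)
    (hp : ContDiffAt ℝ ∞ p z) : ContDiffAt ℝ ∞ (changeE f p) z := by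
  unfold changeE
  exact hf.sub ((contDiffAt_const.mul hp).smul contDiffAt_snd)

lemma fderiv_changeE {f : E × E → E} {p : E × E → ℝ} {z : E × E} (hf : DifferentiableAt ℝ f z)
    (hp : DifferentiableAt ℝ p z) (ξ : E × E) :
    fderiv ℝ (changeE f p) z ξ
      = fderiv ℝ f z ξ - ((2 * p z) • ξ.2 + (2 * fderiv ℝ p z ξ) • z.2) := by
  have h : HasFDerivAt (changeE f p) _ z :=
    hf.hasFDerivAt.sub ((hp.hasFDerivAt.const_mul 2).smul hasFDerivAt_snd)
  rw [h.fderiv]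
  simp

lemma connE_changeE {f : E × E → E} {p : E × E → ℝ} {z : E × E} (hf : DifferentiableAt ℝ f z)
    (hp : DifferentiableAt ℝ p z) (u : E) :
    connE (changeE f p) z u = connE f z u + p z • u + fderiv ℝ p z (0, u) • z.2 := by
  rw [connE_apply, connE_apply, fderiv_changeE hf hp]
  simp only []
  module

lemma QuadraticAt.changeE {f : E × E → E} {p : E × E → ℝ} {z : E × E} (hf : ContDiffAt ℝ ∞ f z)
    (h : QuadraticAt f z) (hp : ContDiffAt ℝ ∞ p z)
    (hh : ∀ᶠ z' in 𝓝 z, fderiv ℝ p z' (0, z'.2) = p z') : QuadraticAt (changeE f p) z := by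
  filter_upwards [h, hh, eventually_differentiableAt hf, eventually_differentiableAt hp]
    with z' h1 h2 h3 h4
  rw [fderiv_changeE h3 h4, h1, h2, SprayGeom.changeE]
  simp only []
  module

lemma nablaE_changeE {f X : E × E → E} {p : E × E → ℝ} {z : E × E} (hf : DifferentiableAt ℝ f z)
    (hp : DifferentiableAt ℝ p z) :
    nablaE (changeE f p) X z = nablaE f X z - (2 * p z) • fderiv ℝ X z (0, z.2) + p z • X z
      + fderiv ℝ p z (0, X z) • z.2 := by
  have h : sodeE (changeE f p) z = sodeE f z - (2 * p z) • ((0 : E), z.2) := by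
    simp [sodeE, changeE]
  rw [nablaE, nablaE, connE_changeE hf hp, h, map_sub, map_smul]
  abel

/-- The identity `Φ̃ = Φ + a·id + b ⊗ T`. It comes from applying `S̃ = S - 2PΔ` to `Γ̃ = Γ + P·id +
d^VP ⊗ T`, where the `Δ`-derivatives are known from the degrees: one for `Γ` and `P`, zero for
`d^VP`. -/
lemma jacobiE_changeE {f : E × E → E} {p : E × E → ℝ} {z : E × E} (hf : ContDiffAt ℝ ∞ f z)
    (h : QuadraticAt f z) (hp : ContDiffAt ℝ ∞ p z)
    (hh : ∀ᶠ z' in 𝓝 z, fderiv ℝ p z' (0, z'.2) = p z') (u : E) :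
    jacobiE (changeE f p) z u = jacobiE f z u
      + (p z ^ 2 - fderiv ℝ p z (sodeE f z)) • u + bFormE f p z u • z.2 := by
  have hfd := differentiableAt_of_smooth hf
  have hpd := differentiableAt_of_smooth hp
  have hh' : ∀ᶠ z' in 𝓝 z, fderiv ℝ p z' (0, z'.2) = (1 : ℝ) • p z' :=
    hh.mono fun z' hz' => by rw [hz', one_smul]
  have hc : (fun z' => connE (changeE f p) z' u) =ᶠ[𝓝 z] fun z' => connE f z' u + p z' • u
      + fderiv ℝ p z' (0, u) • z'.2 := by
    filter_upwards [eventually_differentiableAt hf, eventually_differentiableAt hp] with z' h3 h4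
    exact connE_changeE h3 h4 u
  have hd : ∀ ξ : E × E, fderiv ℝ (connE (changeE f p)) z ξ u
      = fderiv ℝ (connE f) z ξ u + fderiv ℝ p z ξ • u
        + (fderiv ℝ p z (0, u) • ξ.2 + fderiv ℝ (fderiv ℝ p) z ξ (0, u) • z.2) := by
    intro ξ
    have h1 : fderiv ℝ (fun z' => connE (changeE f p) z' u) z ξ
        = fderiv ℝ (connE (changeE f p)) z ξ u := by
      rw [fderiv_clm_apply (differentiableAt_of_smooth
        (contDiffAt_connE (contDiffAt_changeE hf hp))) (differentiableAt_const _)]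
      simp
    have h2 := ((((differentiableAt_of_smooth (contDiffAt_connE hf)).hasFDerivAt.clm_apply
      (hasFDerivAt_const u z))).add (hpd.hasFDerivAt.smul_const u)).add
      (((differentiableAt_of_smooth (contDiffAt_fderiv hp)).hasFDerivAt.clm_apply
      (hasFDerivAt_const ((0 : E), u) z)).smul (hasFDerivAt_snd (p := z)))
    have h3 : HasFDerivAt (fun z' => connE f z' u + p z' • u + fderiv ℝ p z' (0, u) • z'.2) _ z := h2
    rw [← h1, hc.fderiv_eq, h3.fderiv]
    simp
  have hS : sodeE (changeE f p) z = sodeE f z - (2 * p z) • ((0 : E), z.2) := by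
    simp [sodeE, changeE]
  have hvv : fderiv ℝ (fderiv ℝ p) z (0, z.2) (0, u) = 0 := by
    have := fderiv_fderiv_euler 1 hp hh' (0, u)
    rw [symm_snd hp]
    simpa using this
  have hpT : fderiv ℝ p z (0, z.2) = p z := hh.self_of_nhds
  have hb : fderiv ℝ (fun z' => fderiv ℝ p z' (sodeE f z')) z (0, u)
      = fderiv ℝ (fderiv ℝ p) z (sodeE f z) (0, u) + fderiv ℝ p z (u, 0)
        - 2 * fderiv ℝ p z (0, connE f z u) := by
    rw [fderiv_along hp (differentiableAt_of_smooth (contDiffAt_sodeE hf)), fderiv_sodeE hfd,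
      symm_snd hp, fderiv_vert]
    simp only []
    rw [fderiv_split p z u]
    have : ((0 : E), -((2 : ℝ) • connE f z u)) = (-2 : ℝ) • ((0 : E), connE f z u) := by simp
    rw [this, map_smul, smul_eq_mul]; ring
  have hHu : fderiv ℝ p z (u, -connE f z u) = fderiv ℝ p z (u, 0) - fderiv ℝ p z (0, connE f z u) := by
    rw [← map_sub]; simp
  have hS2 : (sodeE (changeE f p) z).2 = f z - (2 * p z) • z.2 := rfl
  have hpS2 : fderiv ℝ p z (0, connE f z u + p z • u + fderiv ℝ p z (0, u) • z.2)
      = fderiv ℝ p z (0, connE f z u) + p z * fderiv ℝ p z (0, u) + fderiv ℝ p z (0, u) * p z := by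
    have : ((0 : E), connE f z u + p z • u + fderiv ℝ p z (0, u) • z.2)
      = ((0 : E), connE f z u) + p z • ((0 : E), u) + fderiv ℝ p z (0, u) • ((0 : E), z.2) := by simp
    rw [this, map_add, map_add, map_smul, map_smul, hpT]; simp
  have hdf : fderiv ℝ (connE (changeE f p)) z (sodeE (changeE f p) z) u
      = fderiv ℝ (connE f) z (sodeE f z) u - (2 * p z) • connE f z u
        + (fderiv ℝ p z (sodeE f z) - 2 * p z * p z) • u
        + (fderiv ℝ p z (0, u) • (f z - (2 * p z) • z.2)
          + fderiv ℝ (fderiv ℝ p) z (sodeE f z) (0, u) • z.2) := by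
    rw [hd, hS2, hS]
    simp only [map_sub, map_smul, sub_apply, smul_apply, h.fderiv_connE_vert hf, hvv, hpT,
      mul_zero, sub_zero, smul_eq_mul]
  have hcc := connE_changeE hfd hpd (connE (changeE f p) z u)
  have hcu : connE f z (connE f z u + p z • u + fderiv ℝ p z (0, u) • z.2)
      = connE f z (connE f z u) + p z • connE f z u - fderiv ℝ p z (0, u) • f z := by
    rw [map_add, map_add, map_smul, map_smul, h.connE_snd, smul_neg, sub_eq_add_neg]
  rw [connE_changeE hfd hpd u, hpS2, hcu] at hcc
  rw [jacobiE_apply, jacobiE_apply, hdf, connE_changeE hfd hpd u, hcc, fderiv_changeE hfd hpd,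
    bFormE, hb, hHu]
  simp only []
  module

/-! ### Changes of natural coordinates -/

/-- The change of natural coordinates on the tangent bundle induced by a change of coordinates. -/
def tangentMapE (τ : E → E) (z : E × E) : E × E := (τ z.1, fderiv ℝ τ z.1 z.2)

/-- The horizontal lift of a field along the projection. -/
def hliftE (f X : E × E → E) (z : E × E) : E × E := (X z, -connE f z (X z))

lemma contDiffAt_tangentMapE {τ : E → E} {z : E × E} (hτ : ContDiffAt ℝ ∞ τ z.1) :
    ContDiffAt ℝ ∞ (tangentMapE τ) z := by
  have h1 : ContDiffAt ℝ ∞ (fun z : E × E => τ z.1) z := hτ.comp z contDiffAt_fst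
  have h2 : ContDiffAt ℝ ∞ (fun z : E × E => fderiv ℝ τ z.1) z :=
    ContDiffAt.comp z (hτ.fderiv_right (by simp)) contDiffAt_fst
  exact h1.prodMk (h2.clm_apply contDiffAt_snd)

lemma fderiv_tangentMapE {τ : E → E} {z : E × E} (hτ : ContDiffAt ℝ ∞ τ z.1) (ξ : E × E) :
    fderiv ℝ (tangentMapE τ) z ξ = (fderiv ℝ τ z.1 ξ.1,
      fderiv ℝ (fderiv ℝ τ) z.1 ξ.1 z.2 + fderiv ℝ τ z.1 ξ.2) := by
  have h1 : HasFDerivAt (fun z : E × E => τ z.1) _ z :=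
    HasFDerivAt.comp z (hτ.differentiableAt (by simp)).hasFDerivAt hasFDerivAt_fst
  have h2 : HasFDerivAt (fun z : E × E => fderiv ℝ τ z.1) _ z :=
    HasFDerivAt.comp z ((hτ.fderiv_right (m := ∞) (by simp)).differentiableAt
      (by simp)).hasFDerivAt hasFDerivAt_fst
  have h3 : HasFDerivAt (tangentMapE τ) _ z := h1.prodMk (h2.clm_apply hasFDerivAt_snd)
  rw [h3.fderiv]
  simp [add_comm]

/-- Brackets of related vector fields are related. -/
lemma fderiv_bracket_of_related {κ V W V' W' : E × E → E × E} {z : E × E}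
    (hκ : ContDiffAt ℝ ∞ κ z) (hV : DifferentiableAt ℝ V z) (hW : DifferentiableAt ℝ W z)
    (hV' : DifferentiableAt ℝ V' (κ z)) (hW' : DifferentiableAt ℝ W' (κ z))
    (hVV : ∀ᶠ z' in 𝓝 z, V' (κ z') = fderiv ℝ κ z' (V z'))
    (hWW : ∀ᶠ z' in 𝓝 z, W' (κ z') = fderiv ℝ κ z' (W z')) :
    fderiv ℝ W' (κ z) (V' (κ z)) - fderiv ℝ V' (κ z) (W' (κ z))
      = fderiv ℝ κ z (fderiv ℝ W z (V z) - fderiv ℝ V z (W z)) := by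
  -- Differentiate the relation itself. The second derivative of `κ` enters symmetrically and
  -- cancels in the bracket.
  have key : ∀ {A A' : E × E → E × E}, DifferentiableAt ℝ A z → DifferentiableAt ℝ A' (κ z) →
      (∀ᶠ z' in 𝓝 z, A' (κ z') = fderiv ℝ κ z' (A z')) → ∀ ξ,
      fderiv ℝ A' (κ z) (fderiv ℝ κ z ξ)
        = fderiv ℝ (fderiv ℝ κ) z ξ (A z) + fderiv ℝ κ z (fderiv ℝ A z ξ) := by
    intro A A' hA hA' h ξ
    rw [← fderiv_along hκ hA, ← EventuallyEq.fderiv_eq (f₁ := fun z' => A' (κ z')) h]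
    have := fderiv_comp z hA' (differentiableAt_of_smooth hκ)
    exact (congrArg (fun L : E × E →L[ℝ] E × E => L ξ) this).symm
  rw [hVV.self_of_nhds, hWW.self_of_nhds, key hW hW' hWW, key hV hV' hVV, symm_snd hκ, map_sub]
  abel

/-- This is `[S, X^H] = (∇X)^H + (ΦX)^V`: both `∇` and `Φ` are encoded in one Lie bracket, so they
inherit its naturality. -/
lemma bracket_hliftE {f X : E × E → E} {z : E × E} (hf : ContDiffAt ℝ ∞ f z)
    (hX : DifferentiableAt ℝ X z) :
    fderiv ℝ (hliftE f X) z (sodeE f z) - fderiv ℝ (sodeE f) z (hliftE f X z)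
      = (nablaE f X z, -connE f z (nablaE f X z) + jacobiE f z (X z)) := by
  have hG := differentiableAt_of_smooth (contDiffAt_connE hf)
  have h : HasFDerivAt (hliftE f X) _ z :=
    hX.hasFDerivAt.prodMk (hG.hasFDerivAt.clm_apply hX.hasFDerivAt).neg
  rw [h.fderiv, fderiv_sodeE (differentiableAt_of_smooth hf), jacobiE_apply, hliftE, nablaE,
    fderiv_split f z (X z), fderiv_vert]
  refine Prod.ext (by simp) ?_
  simp [two_smul]
  abel

lemma differentiableAt_hliftE {f X : E × E → E} {z : E × E} (hf : ContDiffAt ℝ ∞ f z)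
    (hX : DifferentiableAt ℝ X z) : DifferentiableAt ℝ (hliftE f X) z :=
  hX.prodMk ((differentiableAt_of_smooth (contDiffAt_connE hf)).clm_apply hX).neg

/-- Transformation law of the connection coefficients. -/
lemma connE_tangentMapE {τ : E → E} {f g : E × E → E} {z : E × E} (hτ : ContDiffAt ℝ ∞ τ z.1)
    (hf : ContDiffAt ℝ ∞ f z) (hg : ContDiffAt ℝ ∞ g (tangentMapE τ z))
    (hS : ∀ᶠ z' in 𝓝 z, sodeE g (tangentMapE τ z') = fderiv ℝ (tangentMapE τ) z' (sodeE f z'))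
    (hτ' : ∀ᶠ z' : E × E in 𝓝 z, ContDiffAt ℝ ∞ τ z'.1) (u : E) :
    connE g (tangentMapE τ z) (fderiv ℝ τ z.1 u)
      = fderiv ℝ τ z.1 (connE f z u) - fderiv ℝ (fderiv ℝ τ) z.1 u z.2 := by
  have hS' : (fun z' => g (tangentMapE τ z')) =ᶠ[𝓝 z] fun z' =>
      fderiv ℝ (fderiv ℝ τ) z'.1 z'.2 z'.2 + fderiv ℝ τ z'.1 (f z') := by
    filter_upwards [hS, hτ'] with z' h1 h2
    rw [fderiv_tangentMapE h2] at h1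
    exact congrArg Prod.snd h1
  have h1 : HasFDerivAt (fun z : E × E => fderiv ℝ τ z.1) _ z :=
    HasFDerivAt.comp z ((hτ.fderiv_right (m := ∞) (by simp)).differentiableAt
      (by simp)).hasFDerivAt hasFDerivAt_fst
  have h2 : HasFDerivAt (fun z : E × E => fderiv ℝ (fderiv ℝ τ) z.1) _ z :=
    HasFDerivAt.comp z (((hτ.fderiv_right (m := ∞) (by simp)).fderiv_right
      (m := ∞) (by simp)).differentiableAt (by simp)).hasFDerivAt hasFDerivAt_fst
  have h3 := ((h2.clm_apply hasFDerivAt_snd).clm_apply hasFDerivAt_snd).add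
    (h1.clm_apply (differentiableAt_of_smooth hf).hasFDerivAt)
  have h4 := congrArg (fun L : E × E →L[ℝ] E => L (0, u)) (hS'.fderiv_eq.trans h3.fderiv)
  have h5 := fderiv_comp z (differentiableAt_of_smooth hg)
    (differentiableAt_of_smooth (contDiffAt_tangentMapE hτ))
  have h6 : fderiv ℝ (fun z' => g (tangentMapE τ z')) z (0, u)
      = fderiv ℝ g (tangentMapE τ z) (0, fderiv ℝ τ z.1 u) := by
    have := congrArg (fun L : E × E →L[ℝ] E => L (0, u)) h5
    refine this.trans ?_
    simp [fderiv_tangentMapE hτ]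
  -- The quadratic term of `hS'` has two slots `ẋ`. By symmetry they contribute equally to the
  -- vertical derivative, and the factor `-1/2` leaves a single inhomogeneous term.
  have h7 : fderiv ℝ (fderiv ℝ τ) z.1 z.2 u = fderiv ℝ (fderiv ℝ τ) z.1 u z.2 :=
    (hτ.isSymmSndFDerivAt (by
      rw [minSmoothness_of_isRCLikeNormedField]; exact WithTop.coe_le_coe.2 le_top)) _ _
  rw [connE_apply, ← h6, h4, connE_apply]
  simp [h7, fderiv_vert]
  module

lemma hliftE_tangentMapE {τ : E → E} {f g X Y : E × E → E} {z : E × E}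
    (hτ : ContDiffAt ℝ ∞ τ z.1)
    (hf : ContDiffAt ℝ ∞ f z) (hg : ContDiffAt ℝ ∞ g (tangentMapE τ z))
    (hS : ∀ᶠ z' in 𝓝 z, sodeE g (tangentMapE τ z') = fderiv ℝ (tangentMapE τ) z' (sodeE f z'))
    (hτ' : ∀ᶠ z' : E × E in 𝓝 z, ContDiffAt ℝ ∞ τ z'.1)
    (hX : Y (tangentMapE τ z) = fderiv ℝ τ z.1 (X z)) :
    hliftE g Y (tangentMapE τ z) = fderiv ℝ (tangentMapE τ) z (hliftE f X z) := by
  rw [fderiv_tangentMapE hτ, hliftE, hX, connE_tangentMapE hτ hf hg hS hτ']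
  simp [hliftE, sub_eq_add_neg]

/-- The dynamical covariant derivative and the Jacobi endomorphism are independent of the
coordinates. -/
lemma nablaE_jacobiE_tangentMapE {τ : E → E} {f g X Y : E × E → E} {z : E × E}
    (hτ : ∀ᶠ z' : E × E in 𝓝 z, ContDiffAt ℝ ∞ τ z'.1)
    (hf : ∀ᶠ z' in 𝓝 z, ContDiffAt ℝ ∞ f z')
    (hg : ∀ᶠ z' in 𝓝 z, ContDiffAt ℝ ∞ g (tangentMapE τ z'))
    (hS : ∀ᶠ z' in 𝓝 z, sodeE g (tangentMapE τ z') = fderiv ℝ (tangentMapE τ) z' (sodeE f z'))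
    (hX : DifferentiableAt ℝ X z) (hY : DifferentiableAt ℝ Y (tangentMapE τ z))
    (hXY : ∀ᶠ z' in 𝓝 z, Y (tangentMapE τ z') = fderiv ℝ τ z'.1 (X z')) :
    nablaE g Y (tangentMapE τ z) = fderiv ℝ τ z.1 (nablaE f X z) ∧
      jacobiE g (tangentMapE τ z) (Y (tangentMapE τ z))
        = fderiv ℝ τ z.1 (jacobiE f z (X z)) := by
  have hτ0 : ContDiffAt ℝ ∞ τ z.1 := hτ.self_of_nhds
  have hf0 := hf.self_of_nhds
  have hg0 := hg.self_of_nhds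
  have hh : ∀ᶠ z' in 𝓝 z, hliftE g Y (tangentMapE τ z')
      = fderiv ℝ (tangentMapE τ) z' (hliftE f X z') := by
    filter_upwards [hτ, hf, hg, hXY, eventually_eventually_nhds.2 hS,
      eventually_eventually_nhds.2 hτ] with z' h1 h2 h3 h4 h5 h6
    exact hliftE_tangentMapE h1 h2 h3 h5 h6 h4
  -- Both `S` and the horizontal lift are related, hence so are their brackets. The first component
  -- yields `∇X`; the second yields `Φ(X)` after the transformation law of `Γ` is used.
  have key := fderiv_bracket_of_related (contDiffAt_tangentMapE hτ0)
    (differentiableAt_of_smooth (contDiffAt_sodeE hf0)) (differentiableAt_hliftE hf0 hX)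
    (differentiableAt_of_smooth (contDiffAt_sodeE hg0)) (differentiableAt_hliftE hg0 hY) hS hh
  rw [bracket_hliftE hf0 hX, bracket_hliftE hg0 hY, fderiv_tangentMapE hτ0] at key
  have k1 := congrArg Prod.fst key
  have k2 := congrArg Prod.snd key
  simp only [] at k1 k2
  refine ⟨k1, ?_⟩
  rw [k1, connE_tangentMapE hτ0 hf0 hg0 hS hτ, map_add, map_neg] at k2
  have k3 := sub_eq_zero.2 k2
  rw [← sub_eq_zero, ← k3]
  abel

/-- Homogeneity is independent of the coordinates. -/
lemma quadratic_tangentMapE {τ : E → E} {f g : E × E → E} {z : E × E}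
    (hτ : ContDiffAt ℝ ∞ τ z.1)
    (hf : ContDiffAt ℝ ∞ f z) (hg : ContDiffAt ℝ ∞ g (tangentMapE τ z))
    (hS : ∀ᶠ z' in 𝓝 z, sodeE g (tangentMapE τ z') = fderiv ℝ (tangentMapE τ) z' (sodeE f z'))
    (hτ' : ∀ᶠ z' : E × E in 𝓝 z, ContDiffAt ℝ ∞ τ z'.1)
    (hq : fderiv ℝ f z (0, z.2) = (2 : ℝ) • f z) :
    fderiv ℝ g (tangentMapE τ z) (0, (tangentMapE τ z).2) = (2 : ℝ) • g (tangentMapE τ z) := by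
  have h1 := hS.self_of_nhds
  rw [fderiv_tangentMapE hτ] at h1
  have h2 : g (tangentMapE τ z) = _ := congrArg Prod.snd h1
  have h3 := connE_tangentMapE hτ hf hg hS hτ' z.2
  have h4 : connE f z z.2 = -f z := by
    rw [connE_apply, hq, smul_smul]; norm_num
  rw [fderiv_vert, h2]
  change -((2 : ℝ) • connE g (tangentMapE τ z) (fderiv ℝ τ z.1 z.2)) = _
  rw [h3, h4]
  simp only [sodeE, map_neg]
  module

end Euclidean

/-! ### Natural charts of `TM`, coordinate expressions and their transition maps. -/

section Charts

variable {E : Type*} [NormedAddCommGroup E] [NormedSpace ℝ E]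
  {M : Type*} [TopologicalSpace M] [ChartedSpace E M] [IsManifold 𝓘(ℝ, E) ∞ M]
  {F : Type*} [NormedAddCommGroup F] [NormedSpace ℝ F]

/-- The natural chart of `TM` given by `q`. -/
def natChart (q : M) : PartialEquiv (TB E M) (E × E) :=
  extChartAt 𝓘(ℝ, E).tangent (⟨q, 0⟩ : TB E M)

/-- The change of coordinates of `M` from the preferred chart at `p` to the one at `q`. -/
def transition (E : Type*) [NormedAddCommGroup E] [NormedSpace ℝ E] {M : Type*}
    [TopologicalSpace M] [ChartedSpace E M] (p q : M) : E → E :=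
  extChartAt 𝓘(ℝ, E) q ∘ (extChartAt 𝓘(ℝ, E) p).symm

/-- The coordinate expression of a function on `TM`. -/
def rep {V : Type*} (q : M) (g : TB E M → V) : E × E → V := g ∘ (natChart q).symm

/-- The derivative at `w` of the change of coordinates of `M` from the preferred chart at the base
point of `w` to the one at `q`. -/
def baseFrame (q : M) (w : TB E M) : E →L[ℝ] E :=
  fderiv ℝ (transition E w.proj q) (natChart w.proj w).1

/-- The components of a vector field along the projection. -/
def compt (q : M) (X : TB E M → E) : E × E → E := rep q (fun w => baseFrame q w (X w))

/-- `dAt`, with the tangent spaces of `TM` identified with the model space. -/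
def dModel (g : TB E M → F) (v : TB E M) : E × E →L[ℝ] F := dAt g v

lemma mem_natChart_source {q : M} {w : TB E M} :
    w ∈ (natChart q).source ↔ w.proj ∈ (chartAt E q).source := by
  simp [natChart]

lemma mem_natChart_source_self (w : TB E M) : w ∈ (natChart w.proj).source :=
  mem_natChart_source.2 (mem_chart_source E w.proj)

lemma isOpen_natChart_source (q : M) : IsOpen (natChart (E := E) q).source :=
  isOpen_extChartAt_source _

lemma isOpen_natChart_target (q : M) : IsOpen (natChart (E := E) q).target :=
  isOpen_extChartAt_target _

lemma eventually_natChart {q : M} {w : TB E M} (hw : w ∈ (natChart q).source)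
    {p : TB E M → Prop} (h : ∀ᶠ w' in 𝓝 w, p w') :
    ∀ᶠ z in 𝓝 (natChart q w), z ∈ (natChart q).target ∧ (natChart q).symm z ∈ (natChart q).source
      ∧ p ((natChart q).symm z) := by
  have h1 : ContinuousAt (natChart (E := E) q).symm (natChart q w) :=
    continuousAt_extChartAt_symm' hw
  have h2 : ∀ᶠ w' in 𝓝 ((natChart q).symm (natChart q w)), p w' := by
    rwa [(natChart q).left_inv hw]
  filter_upwards [(isOpen_natChart_target q).mem_nhds ((natChart q).map_source hw), h1.eventually h2]
    with z hz hz'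
  exact ⟨hz, (natChart q).map_target hz, hz'⟩

lemma continuousAt_natChart {q : M} {w : TB E M} (hw : w ∈ (natChart q).source) :
    ContinuousAt (natChart (E := E) q) w := continuousAt_extChartAt' hw

lemma contMDiffAt_iff_rep {q : M} {w : TB E M} (hw : w ∈ (natChart q).source)
    {g : TB E M → F} :
    ContMDiffAt 𝓘(ℝ, E).tangent 𝓘(ℝ, F) ∞ g w ↔ ContDiffAt ℝ ∞ (rep q g) (natChart q w) := by
  rw [contMDiffAt_iff_source_of_mem_source (x := (⟨q, 0⟩ : TB E M)) (by simpa [natChart] using hw)]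
  rw [ModelWithCorners.range_eq_univ, contMDiffWithinAt_univ, contMDiffAt_iff_contDiffAt]
  rfl

lemma rep_natChart {V : Type*} {q : M} {w : TB E M} (hw : w ∈ (natChart q).source)
    (g : TB E M → V) :
    rep q g (natChart q w) = g w := by
  rw [rep, Function.comp_apply, (natChart q).left_inv hw]

lemma fibreCoord_eq (q : M) (w : TB E M) : fibreCoord q w = (natChart q w).2 := rfl

lemma tangentCoordChange_eq_fderiv (p q m : M) : tangentCoordChange 𝓘(ℝ, E) p q m
    = fderiv ℝ (transition E p q) (extChartAt 𝓘(ℝ, E) p m) := by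
  rw [tangentCoordChange_def, ModelWithCorners.range_eq_univ, fderivWithin_univ]
  rfl

/-- A vector at a point is stored in the preferred chart of that point, so reading it in the chart
of `q` applies the coordinate change between these two charts. -/
lemma fibreCoord_mk {q : M} (w : TB E M) (u : E) :
    fibreCoord q (⟨w.proj, u⟩ : TB E M) = baseFrame q w u :=
  congrArg (fun L : E →L[ℝ] E => L u) (tangentCoordChange_eq_fderiv w.proj q w.proj)

lemma natChart_snd (q : M) (w : TB E M) : (natChart q w).2 = baseFrame q w w.snd :=
  fibreCoord_mk w w.snd

lemma baseFrame_self (w : TB E M) (u : E) : baseFrame w.proj w u = u :=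
  (fibreCoord_mk w u).symm.trans (tangentCoordChange_self (mem_extChartAt_source _))

lemma natChart_self_snd (w : TB E M) : (natChart w.proj w).2 = w.snd := (natChart_snd _ w).trans (baseFrame_self w w.snd)

lemma contDiffAt_transition {p q : M} {w : TB E M} (hp : w ∈ (natChart p).source)
    (hq : w ∈ (natChart q).source) :
    ContDiffAt ℝ ∞ (transition E p q) (natChart p w).1 := by
  have h : (natChart p w).1 ∈ ((extChartAt 𝓘(ℝ, E) p).symm ≫ extChartAt 𝓘(ℝ, E) q).source := by
    rw [PartialEquiv.trans_source'', PartialEquiv.symm_symm, PartialEquiv.symm_target]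
    refine Set.mem_image_of_mem _ ⟨?_, ?_⟩
    · rw [extChartAt_source]; exact mem_natChart_source.1 hp
    · rw [extChartAt_source]; exact mem_natChart_source.1 hq
  have := contDiffWithinAt_ext_coord_change (I := 𝓘(ℝ, E)) (n := ∞) q p h
  rw [ModelWithCorners.range_eq_univ, contDiffWithinAt_univ] at this
  exact this

lemma natChart_transition {p q : M} {w : TB E M} (hp : w ∈ (natChart p).source)
    (hq : w ∈ (natChart q).source) :
    tangentMapE (transition E p q) (natChart p w) = natChart q w := by
  rw [mem_natChart_source] at hp hq
  refine Prod.ext ?_ ?_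
  · change extChartAt 𝓘(ℝ, E) q ((extChartAt 𝓘(ℝ, E) p).symm (extChartAt 𝓘(ℝ, E) p w.proj)) = _
    rw [(extChartAt 𝓘(ℝ, E) p).left_inv (by rwa [extChartAt_source])]
    rfl
  -- Cocycle rule from the preferred chart of the base point, where `w.snd` is stored, through `p`
  -- to `q`.
  · have h := tangentCoordChange_comp (I := 𝓘(ℝ, E)) (w := w.proj) (x := p) (y := q) (z := w.proj)
      (v := w.snd) (by simp only [extChartAt_source]; exact ⟨⟨mem_chart_source E _, hp⟩, hq⟩)
    refine Eq.trans ?_ h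
    exact (congrArg (fun L : E →L[ℝ] E => L (natChart p w).2)
      (tangentCoordChange_eq_fderiv p q w.proj)).symm

lemma eventually_transition {p q : M} {w : TB E M} (hp : w ∈ (natChart p).source)
    (hq : w ∈ (natChart q).source) : ∀ᶠ z in 𝓝 (natChart p w),
      ContDiffAt ℝ ∞ (transition E p q) z.1 ∧
      tangentMapE (transition E p q) z = natChart q ((natChart p).symm z) := by
  filter_upwards [eventually_natChart hp ((isOpen_natChart_source q).mem_nhds hq)] with z hz
  have h1 := contDiffAt_transition hz.2.1 hz.2.2
  have h2 := natChart_transition hz.2.1 hz.2.2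
  rw [(natChart p).right_inv hz.1] at h1 h2
  exact ⟨h1, h2⟩

/-- The differential at `w` of the natural chart given by `q`. -/
def frame (q : M) (w : TB E M) : E × E →L[ℝ] E × E :=
  fderiv ℝ (tangentMapE (transition E w.proj q)) (natChart w.proj w)

lemma frame_apply {q : M} {w : TB E M} (hq : w ∈ (natChart q).source) (ξ : E × E) :
    frame q w ξ = (baseFrame q w ξ.1,
      fderiv ℝ (fderiv ℝ (transition E w.proj q)) (natChart w.proj w).1 ξ.1 (natChart w.proj w).2
        + baseFrame q w ξ.2) := by
  rw [frame, fderiv_tangentMapE (contDiffAt_transition (mem_natChart_source_self w) hq)]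
  rfl

lemma frame_trans {p q : M} {w : TB E M} (hp : w ∈ (natChart p).source)
    (hq : w ∈ (natChart q).source) (ξ : E × E) :
    frame q w ξ = fderiv ℝ (tangentMapE (transition E p q)) (natChart p w) (frame p w ξ) := by
  have h0 := mem_natChart_source_self w
  have h : tangentMapE (transition E w.proj q) =ᶠ[𝓝 (natChart w.proj w)]
      tangentMapE (transition E p q) ∘ tangentMapE (transition E w.proj p) := by
    filter_upwards [eventually_transition h0 hq, eventually_transition h0 hp,
      eventually_natChart h0 ((isOpen_natChart_source p).mem_nhds hp),
      eventually_natChart h0 ((isOpen_natChart_source q).mem_nhds hq)] with z h1 h2 h3 h4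
    rw [h1.2, Function.comp_apply, h2.2, natChart_transition h3.2.2 h4.2.2]
  rw [frame, h.fderiv_eq, fderiv_comp]
  · rw [natChart_transition h0 hp]; rfl
  · rw [natChart_transition h0 hp]
    exact differentiableAt_of_smooth (contDiffAt_tangentMapE (contDiffAt_transition hp hq))
  · exact differentiableAt_of_smooth (contDiffAt_tangentMapE (contDiffAt_transition h0 hp))

lemma dModel_self {g : TB E M → F} {w : TB E M}
    (hg : DifferentiableAt ℝ (rep w.proj g) (natChart w.proj w)) :
    dModel g w = fderiv ℝ (rep w.proj g) (natChart w.proj w) := by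
  have hw := mem_natChart_source_self w
  have hc : ContinuousAt g w := by
    have h1 : ContinuousAt (rep w.proj g ∘ natChart w.proj) w :=
      hg.continuousAt.comp (continuousAt_natChart hw)
    refine h1.congr ?_
    filter_upwards [(isOpen_natChart_source w.proj).mem_nhds hw] with w' hw'
    exact rep_natChart hw' g
  have hm : MDifferentiableAt 𝓘(ℝ, E).tangent 𝓘(ℝ, F) g w := by
    rw [mdifferentiableAt_iff]
    refine ⟨hc, ?_⟩
    rw [ModelWithCorners.range_eq_univ, differentiableWithinAt_univ]
    exact hg
  have h : dModel g w = fderivWithin ℝ (rep w.proj g) (Set.range 𝓘(ℝ, E).tangent)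
      (natChart w.proj w) := if_pos hm
  rw [h, ModelWithCorners.range_eq_univ, fderivWithin_univ]

/-- The differential at `w` is expressed in the preferred chart of the base point, which moves with
`w`; `frame` carries its argument over to the fixed chart of `q`. -/
lemma dModel_eq {q : M} {w : TB E M} (hq : w ∈ (natChart q).source) {g : TB E M → F}
    (hg : DifferentiableAt ℝ (rep q g) (natChart q w)) (ξ : E × E) :
    dModel g w ξ = fderiv ℝ (rep q g) (natChart q w) (frame q w ξ) := by
  have h0 := mem_natChart_source_self w
  have h : rep w.proj g =ᶠ[𝓝 (natChart w.proj w)]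
      rep q g ∘ tangentMapE (transition E w.proj q) := by
    filter_upwards [eventually_transition h0 hq,
      eventually_natChart h0 ((isOpen_natChart_source q).mem_nhds hq)] with z h1 h2
    rw [Function.comp_apply, h1.2, rep_natChart h2.2.2]; rfl
  have hd := differentiableAt_of_smooth
    (contDiffAt_tangentMapE (contDiffAt_transition h0 hq))
  have hg' : DifferentiableAt ℝ (rep q g)
      (tangentMapE (transition E w.proj q) (natChart w.proj w)) := by
    rwa [natChart_transition h0 hq]
  rw [dModel_self (h.differentiableAt_iff.2 (hg'.comp _ hd)), h.fderiv_eq, fderiv_comp _ hg' hd,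
    natChart_transition h0 hq]
  rfl

lemma frame_vert {q : M} {w : TB E M} (hq : w ∈ (natChart q).source) (u : E) :
    frame q w (0, u) = (0, baseFrame q w u) := by
  simp [frame_apply hq]

/-- In the trivialization at `q` the map `X : TM → TM` splits into its base part, which is the
smooth projection, and its fibre components. -/
lemma smoothAlong_at_iff {q : M} {w : TB E M} (hq : w ∈ (natChart q).source)
    {X : TB E M → E} :
    ContMDiffAt 𝓘(ℝ, E).tangent 𝓘(ℝ, E).tangent ∞ (fun v => (⟨v.proj, X v⟩ : TB E M)) w ↔
      ContDiffAt ℝ ∞ (compt q X) (natChart q w) := by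
  rw [compt, ← contMDiffAt_iff_rep hq,
    (trivializationAt E (TangentSpace 𝓘(ℝ, E)) q).contMDiffAt_iff (IB := 𝓘(ℝ, E))]
  · have e : (fun w => baseFrame q w (X w)) = fun w : TB E M =>
        (trivializationAt E (TangentSpace 𝓘(ℝ, E)) q (⟨w.proj, X w⟩ : TB E M)).2 :=
      funext fun w => (fibreCoord_mk w (X w)).symm
    rw [e]
    exact ⟨fun h => h.2, fun h => ⟨Bundle.contMDiffAt_proj _, h⟩⟩
  · exact (TangentBundle.trivializationAt_source (I := 𝓘(ℝ, E)) q) ▸ mem_natChart_source.1 hq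

lemma SmoothAlong.contDiffAt {U : Set (TB E M)} (hU : IsOpen U) {X : FieldAlong E M}
    (hX : SmoothAlong U X) {w : TB E M} (hw : w ∈ U) {q : M} (hq : w ∈ (natChart q).source) :
    ContDiffAt ℝ ∞ (compt q X) (natChart q w) :=
  (smoothAlong_at_iff hq).1 ((hX w hw).contMDiffAt (hU.mem_nhds hw))

lemma smoothAlong_of_contDiffAt {U : Set (TB E M)} {X : FieldAlong E M}
    (h : ∀ w ∈ U, ContDiffAt ℝ ∞ (compt w.proj X) (natChart w.proj w)) : SmoothAlong U X :=
  fun w hw => ((smoothAlong_at_iff (mem_natChart_source_self w)).2 (h w hw)).contMDiffWithinAt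

lemma isOpen_slit : IsOpen (slit E M) := by
  rw [isOpen_iff_mem_nhds]
  intro w hw
  have h0 := mem_natChart_source_self w
  have h1 : ContinuousAt (fun w' => (natChart w.proj w').2) w :=
    continuous_snd.continuousAt.comp (continuousAt_natChart h0)
  have h2 : (natChart w.proj w).2 ≠ 0 := by rw [natChart_self_snd]; exact hw
  filter_upwards [h1.eventually_ne h2] with w' hw' h3
  apply hw'
  rw [natChart_snd]
  exact (congrArg (baseFrame w.proj w') h3).trans (map_zero _)

end Charts

/-! ### Second-order fields and sprays on the manifold, expressed in natural charts. -/

section Sodes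

variable {E : Type*} [NormedAddCommGroup E] [NormedSpace ℝ E]
  {M : Type*} [TopologicalSpace M] [ChartedSpace E M] [IsManifold 𝓘(ℝ, E) ∞ M]
  {F : Type*} [NormedAddCommGroup F] [NormedSpace ℝ F]

/-- The force coefficients as functions of the natural coordinates. -/
def forceE (S : FieldOn E M) (q : M) : E × E → E := rep q (force S q)

/-- A vector field on `TM`, with the tangent spaces of `TM` identified with the model space. -/
def fieldModel (S : FieldOn E M) (w : TB E M) : E × E := S w

/-- A second-order vector field, smooth on the slit tangent bundle. -/
structure IsSode (S : FieldOn E M) : Prop where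
  fst : ∀ w ∈ slit E M, (fieldModel S w).1 = w.snd
  smooth : ∀ w ∈ slit E M, ∀ q : M, w ∈ (natChart q).source →
    ContDiffAt ℝ ∞ (forceE S q) (natChart q w)

lemma rep_fibreCoord_eventuallyEq {q : M} {w : TB E M} (hq : w ∈ (natChart q).source) :
    rep q (fibreCoord q) =ᶠ[𝓝 (natChart q w)] Prod.snd := by
  filter_upwards [(isOpen_natChart_target q).mem_nhds ((natChart q).map_source hq)] with z hz
  rw [rep, Function.comp_apply, fibreCoord_eq, (natChart q).right_inv hz]

lemma dModel_fibreCoord {q : M} {w : TB E M} (hq : w ∈ (natChart q).source) (ξ : E × E) :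
    dModel (fibreCoord q) w ξ = (frame q w ξ).2 := by
  have h := rep_fibreCoord_eventuallyEq hq
  rw [dModel_eq hq (h.differentiableAt_iff.2 differentiableAt_snd), h.fderiv_eq, fderiv_snd]
  rfl

lemma force_eq {S : FieldOn E M} {q : M} {w : TB E M} (hq : w ∈ (natChart q).source) :
    force S q w = (frame q w (fieldModel S w)).2 :=
  dModel_fibreCoord hq (S w)

lemma frame_eq_sodeE {S : FieldOn E M} {q : M} {w : TB E M}
    (hfst : (fieldModel S w).1 = w.snd) (hq : w ∈ (natChart q).source) :
    frame q w (fieldModel S w) = sodeE (forceE S q) (natChart q w) := by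
  refine Prod.ext ?_ ?_
  · refine (congrArg Prod.fst (frame_apply hq _)).trans ?_
    exact (congrArg (baseFrame q w) hfst).trans (natChart_snd q w).symm
  · rw [sodeE, forceE, rep_natChart hq, force_eq hq]

lemma IsSode.eventually {S : FieldOn E M} (hS : IsSode S) {w : TB E M} (hw : w ∈ slit E M)
    {q : M} (hq : w ∈ (natChart q).source) :
    ∀ᶠ z in 𝓝 (natChart q w), ContDiffAt ℝ ∞ (forceE S q) z := by
  filter_upwards [eventually_natChart hq (isOpen_slit.mem_nhds hw)] with z hz
  have := hS.smooth _ hz.2.2 q hz.2.1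
  rwa [(natChart q).right_inv hz.1] at this

lemma IsSode.related {S : FieldOn E M} (hS : IsSode S) {w : TB E M} (hw : w ∈ slit E M)
    {p q : M} (hp : w ∈ (natChart p).source) (hq : w ∈ (natChart q).source) :
    ∀ᶠ z in 𝓝 (natChart p w), sodeE (forceE S q) (tangentMapE (transition E p q) z)
      = fderiv ℝ (tangentMapE (transition E p q)) z (sodeE (forceE S p) z) := by
  filter_upwards [eventually_natChart hp (isOpen_slit.mem_nhds hw), eventually_transition hp hq,
    eventually_natChart hp ((isOpen_natChart_source q).mem_nhds hq)] with z h1 h2 h3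
  rw [h2.2, ← frame_eq_sodeE (hS.fst _ h1.2.2) h3.2.2, frame_trans h1.2.1 h3.2.2,
    frame_eq_sodeE (hS.fst _ h1.2.2) h3.2.1, (natChart p).right_inv h3.1]

lemma IsSode.eventually_transition {S : FieldOn E M} (hS : IsSode S) {w : TB E M}
    (hw : w ∈ slit E M) {p q : M} (hp : w ∈ (natChart p).source)
    (hq : w ∈ (natChart q).source) :
    ∀ᶠ z in 𝓝 (natChart p w), ContDiffAt ℝ ∞ (forceE S q) (tangentMapE (transition E p q) z) := by
  filter_upwards [eventually_natChart hp (isOpen_slit.mem_nhds hw),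
    SprayGeom.eventually_transition hp hq,
    eventually_natChart hp ((isOpen_natChart_source q).mem_nhds hq)] with z h1 h2 h3
  rw [h2.2]
  exact hS.smooth _ h1.2.2 q h3.2.2

/-! ### The geometric objects in natural coordinates -/

/-- The derivative along `S`, in coordinates. -/
lemma lieD_eq {S : FieldOn E M} {q : M} {w : TB E M} (hfst : (fieldModel S w).1 = w.snd)
    (hq : w ∈ (natChart q).source) {g : TB E M → F}
    (hg : DifferentiableAt ℝ (rep q g) (natChart q w)) :
    lieD S g w = fderiv ℝ (rep q g) (natChart q w) (sodeE (forceE S q) (natChart q w)) :=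
  (dModel_eq hq hg (fieldModel S w)).trans (by rw [frame_eq_sodeE hfst hq])

lemma conn_eq {S : FieldOn E M} {q : M} {w : TB E M} : conn S q w
    = connE (forceE S q) (natChart q w) := rfl

lemma rep_conn_eventuallyEq {S : FieldOn E M} {q : M} {w : TB E M}
    (hq : w ∈ (natChart q).source) :
    rep q (conn S q) =ᶠ[𝓝 (natChart q w)] connE (forceE S q) := by
  filter_upwards [(isOpen_natChart_target q).mem_nhds ((natChart q).map_source hq)] with z hz
  rw [rep, Function.comp_apply, conn_eq, (natChart q).right_inv hz]

/-- `nabla`, with the tangent spaces of `M` identified with the model space. -/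
def nablaModel (S : FieldOn E M) (X : TB E M → E) : TB E M → E := nabla S X

/-- `jacobi`, with the tangent spaces of `M` identified with the model space. -/
def jacobiModel (S : FieldOn E M) (v : TB E M) : E →L[ℝ] E := jacobi S v

lemma compt_def (q : M) (X : TB E M → E) :
    compt q X = rep q (fun w => fibreCoord q (⟨w.proj, X w⟩ : TB E M)) :=
  congrArg (rep q) (funext fun w => (fibreCoord_mk w (X w)).symm)

lemma compt_natChart {q : M} {w : TB E M} (hq : w ∈ (natChart q).source) (X : TB E M → E) :
    compt q X (natChart q w) = baseFrame q w (X w) := rep_natChart hq _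

lemma compt_self (w : TB E M) (X : TB E M → E) : compt w.proj X (natChart w.proj w) = X w := by
  rw [compt_natChart (mem_natChart_source_self w), baseFrame_self]

lemma nablaModel_self {S : FieldOn E M} {w : TB E M} (hfst : (fieldModel S w).1 = w.snd)
    {X : TB E M → E} (hX : DifferentiableAt ℝ (compt w.proj X) (natChart w.proj w)) :
    nablaModel S X w = nablaE (forceE S w.proj) (compt w.proj X) (natChart w.proj w) := by
  rw [nablaE, compt_self, ← conn_eq]
  have hX' := hX
  rw [compt_def] at hX'
  have h := lieD_eq hfst (mem_natChart_source_self w) hX'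
  rw [← compt_def] at h
  exact congrArg (fun e : E => e + conn S w.proj w (X w)) h

lemma jacobiModel_self {S : FieldOn E M} {w : TB E M} (hfst : (fieldModel S w).1 = w.snd)
    (hS : ContDiffAt ℝ ∞ (forceE S w.proj) (natChart w.proj w)) :
    jacobiModel S w = jacobiE (forceE S w.proj) (natChart w.proj w) := by
  have h0 := rep_conn_eventuallyEq (S := S) (mem_natChart_source_self w)
  have h := lieD_eq hfst (mem_natChart_source_self w) (g := conn S w.proj)
    (h0.differentiableAt_iff.2 (differentiableAt_of_smooth (contDiffAt_connE hS)))
  rw [h0.fderiv_eq] at h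
  rw [jacobiE, ← h]
  rfl

/-- `∇X` and `Φ(X)` in the natural coordinates given by any `q`. -/
lemma IsSode.nabla_jacobi_eq {S : FieldOn E M} (hS : IsSode S) {w : TB E M} (hw : w ∈ slit E M)
    {q : M} (hq : w ∈ (natChart q).source) {X : TB E M → E}
    (hX : ∀ p : M, w ∈ (natChart p).source → DifferentiableAt ℝ (compt p X) (natChart p w)) :
    baseFrame q w (nablaModel S X w) = nablaE (forceE S q) (compt q X) (natChart q w) ∧
      baseFrame q w (jacobiModel S w (X w))
        = jacobiE (forceE S q) (natChart q w) (compt q X (natChart q w)) := by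
  have h0 := mem_natChart_source_self w
  have hXY : ∀ᶠ z in 𝓝 (natChart w.proj w), compt q X (tangentMapE (transition E w.proj q) z)
      = fderiv ℝ (transition E w.proj q) z.1 (compt w.proj X z) := by
    filter_upwards [SprayGeom.eventually_transition h0 hq,
      eventually_natChart h0 ((isOpen_natChart_source q).mem_nhds hq)] with z h2 h3
    have e1 : ∀ u : E, baseFrame q ((natChart w.proj).symm z) u = fderiv ℝ
        (transition E w.proj q) z.1 (baseFrame w.proj ((natChart w.proj).symm z) u) := by
      intro u
      have := congrArg Prod.fst (frame_trans h3.2.1 h3.2.2 (u, 0))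
      rw [frame_apply h3.2.2, (natChart w.proj).right_inv h3.1, fderiv_tangentMapE h2.1,
        frame_apply h3.2.1] at this
      exact this
    rw [h2.2, compt_natChart h3.2.2, e1]
    rfl
  -- Passage from the preferred chart at the base point of `w`, in which `∇` and `Φ` are defined, to
  -- the chart of `q`.
  have key := nablaE_jacobiE_tangentMapE
    ((SprayGeom.eventually_transition h0 hq).mono fun _ h => h.1) (hS.eventually hw h0)
    (hS.eventually_transition hw h0 hq) (hS.related hw h0 hq) (hX _ h0)
    (by rw [natChart_transition h0 hq]; exact hX q hq) hXY
  rw [natChart_transition h0 hq] at key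
  rw [nablaModel_self (hS.fst w hw) (hX _ h0),
    jacobiModel_self (hS.fst w hw) (hS.smooth w hw _ h0), key.1, key.2, compt_self]
  exact ⟨rfl, rfl⟩

/-- The defining chart of `∇` and `Φ` jumps with the point. Near `w` they are rewritten in the
single chart at `w.proj`, where the formulas are visibly smooth. -/
lemma IsSode.smoothAlong_nabla_jacobi {S : FieldOn E M} (hS : IsSode S) {U : Set (TB E M)}
    (hU : IsOpen U) (hUs : U ⊆ slit E M) {X : TB E M → E} (hX : SmoothAlong U X) :
    SmoothAlong U (nablaModel S X) ∧ SmoothAlong U (fun v => jacobiModel S v (X v)) := by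
  have key : ∀ w ∈ U, ∀ᶠ z in 𝓝 (natChart w.proj w),
      compt w.proj (nablaModel S X) z = nablaE (forceE S w.proj) (compt w.proj X) z ∧
      compt w.proj (fun v => jacobiModel S v (X v)) z
        = jacobiE (forceE S w.proj) z (compt w.proj X z) := by
    intro w hw
    filter_upwards [eventually_natChart (mem_natChart_source_self w) (hU.mem_nhds hw)] with z hz
    have := hS.nabla_jacobi_eq (hUs hz.2.2) hz.2.1 (X := X) fun p hp =>
      differentiableAt_of_smooth (SmoothAlong.contDiffAt hU hX hz.2.2 hp)
    rw [(natChart w.proj).right_inv hz.1] at this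
    exact this
  have hXw : ∀ w ∈ U, ContDiffAt ℝ ∞ (compt w.proj X) (natChart w.proj w) := fun w hw =>
    SmoothAlong.contDiffAt hU hX hw (mem_natChart_source_self w)
  have hSw : ∀ w ∈ U, ContDiffAt ℝ ∞ (forceE S w.proj) (natChart w.proj w) := fun w hw =>
    hS.smooth w (hUs hw) _ (mem_natChart_source_self w)
  constructor
  · refine smoothAlong_of_contDiffAt fun w hw => ?_
    exact (contDiffAt_nablaE (hSw w hw) (hXw w hw)).congr_of_eventuallyEq
      ((key w hw).mono fun _ h => h.1)
  · refine smoothAlong_of_contDiffAt fun w hw => ?_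
    exact ((contDiffAt_jacobiE (hSw w hw)).clm_apply (hXw w hw)).congr_of_eventuallyEq
      ((key w hw).mono fun _ h => h.2)

/-! ### Sprays -/

lemma dModel_natChart {q : M} {w : TB E M} (hq : w ∈ (natChart q).source) :
    dModel (natChart q) w = frame q w := by
  have h : rep q (natChart q) =ᶠ[𝓝 (natChart q w)] id := by
    filter_upwards [(isOpen_natChart_target q).mem_nhds ((natChart q).map_source hq)] with z hz
    exact (natChart q).right_inv hz
  refine ContinuousLinearMap.ext fun ξ => ?_
  rw [dModel_eq hq (h.differentiableAt_iff.2 differentiableAt_id), h.fderiv_eq, fderiv_id]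
  rfl

lemma frame_self (w : TB E M) : frame w.proj w = ContinuousLinearMap.id ℝ (E × E) := by
  have h0 := mem_natChart_source_self w
  have h : tangentMapE (transition E w.proj w.proj) =ᶠ[𝓝 (natChart w.proj w)] id := by
    filter_upwards [eventually_transition h0 h0,
      (isOpen_natChart_target w.proj).mem_nhds ((natChart w.proj).map_source h0)] with z h1 h2
    rw [h1.2, (natChart w.proj).right_inv h2]; rfl
  rw [frame, h.fderiv_eq, fderiv_id]

lemma mfderiv_proj_apply (w : TB E M) (ξ : E × E) :
    (mfderiv 𝓘(ℝ, E).tangent 𝓘(ℝ, E) (fun w : TB E M => w.proj) w : E × E →L[ℝ] E) ξ = ξ.1 := by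
  have hm : MDifferentiableAt 𝓘(ℝ, E).tangent 𝓘(ℝ, E) (fun w : TB E M => w.proj) w :=
    (Bundle.contMDiffAt_proj (n := 1) (TangentSpace 𝓘(ℝ, E))).mdifferentiableAt (by simp)
  have h : (mfderiv 𝓘(ℝ, E).tangent 𝓘(ℝ, E) (fun w : TB E M => w.proj) w : E × E →L[ℝ] E)
      = fderivWithin ℝ (fun z : E × E => extChartAt 𝓘(ℝ, E) w.proj ((natChart w.proj).symm z).proj)
        (Set.range 𝓘(ℝ, E).tangent) (natChart w.proj w) := if_pos hm
  have h2 : (fun z : E × E => extChartAt 𝓘(ℝ, E) w.proj ((natChart w.proj).symm z).proj)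
      =ᶠ[𝓝 (natChart w.proj w)] Prod.fst := by
    filter_upwards [(isOpen_natChart_target w.proj).mem_nhds
      ((natChart w.proj).map_source (mem_natChart_source_self w))] with z hz
    exact congrArg Prod.fst ((natChart w.proj).right_inv hz)
  rw [ModelWithCorners.range_eq_univ, fderivWithin_univ, h2.fderiv_eq, fderiv_fst] at h
  exact congrArg (fun L : E × E →L[ℝ] E => L ξ) h

lemma IsSpray.fst {S : FieldOn E M} (hS : IsSpray S) {w : TB E M} (hw : w ∈ slit E M) :
    (fieldModel S w).1 = w.snd :=
  (mfderiv_proj_apply w (S w)).symm.trans (hS.sode w hw)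

lemma tangentCoordChange_natChart {q : M} {w : TB E M} (hq : w ∈ (natChart q).source) :
    tangentCoordChange 𝓘(ℝ, E).tangent w (⟨q, 0⟩ : TB E M) w = frame q w := by
  have h0 := mem_natChart_source_self w
  have h : natChart q ∘ (natChart w.proj).symm =ᶠ[𝓝 (natChart w.proj w)]
      tangentMapE (transition E w.proj q) := by
    filter_upwards [eventually_transition h0 hq] with z hz
    exact hz.2.symm
  rw [tangentCoordChange_def, ModelWithCorners.range_eq_univ, fderivWithin_univ, frame,
    ← h.fderiv_eq]
  rfl

/-- Smoothness of the section `S` is read in the trivialization at `(q, 0)`; the force is the second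
component there. -/
lemma IsSpray.isSode {S : FieldOn E M} (hS : IsSpray S) : IsSode S := by
  refine ⟨fun w hw => hS.fst hw, fun w hw q hq => ?_⟩
  have h1 := (hS.smooth w hw).contMDiffAt (isOpen_slit.mem_nhds hw)
  have h2 := (((trivializationAt (E × E) (TangentSpace 𝓘(ℝ, E).tangent)
    (⟨q, 0⟩ : TB E M)).contMDiffAt_iff (IB := 𝓘(ℝ, E).tangent)
      (by
        refine (TangentBundle.trivializationAt_source (I := 𝓘(ℝ, E).tangent) (⟨q, 0⟩ : TB E M)) ▸ ?_
        simpa [natChart] using hq)).1 h1).2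
  have h3 : (fun v => (trivializationAt (E × E) (TangentSpace 𝓘(ℝ, E).tangent)
      (⟨q, 0⟩ : TB E M) ⟨v, S v⟩).2) =ᶠ[𝓝 w] fun v => frame q v (fieldModel S v) := by
    filter_upwards [(isOpen_natChart_source q).mem_nhds hq] with v hv
    exact congrArg (fun L : E × E →L[ℝ] E × E => L (fieldModel S v))
      (tangentCoordChange_natChart hv)
  have h4 : ContDiffAt ℝ ∞ (rep q fun v => frame q v (fieldModel S v)) (natChart q w) :=
    (contMDiffAt_iff_rep hq).1 (h2.congr_of_eventuallyEq h3.symm)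
  refine (contDiffAt_snd.comp _ h4).congr_of_eventuallyEq ?_
  filter_upwards [eventually_natChart hq (isOpen_slit.mem_nhds hw)] with z hz
  exact force_eq hz.2.1

/-- Pulling back along the inverse chart applies the inverse of its differential, which is the
differential of the chart, that is, `frame`. -/
lemma mpullbackWithin_natChart_symm {q : M} (V : FieldOn E M) {z : E × E}
    (hz : z ∈ (natChart (E := E) q).target) :
    (VectorField.mpullbackWithin 𝓘(ℝ, E × E) 𝓘(ℝ, E).tangent (natChart q).symm V
      (Set.range 𝓘(ℝ, E).tangent) z : E × E)
      = frame q ((natChart q).symm z) (fieldModel V ((natChart q).symm z)) := by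
  have h1 := mfderiv_extChartAt_comp_mfderivWithin_extChartAt_symm (I := 𝓘(ℝ, E).tangent)
    (x := (⟨q, 0⟩ : TB E M)) hz
  have h2 := mfderivWithin_extChartAt_symm_comp_mfderiv_extChartAt (I := 𝓘(ℝ, E).tangent)
    (x := (⟨q, 0⟩ : TB E M)) hz
  have h3 := ContinuousLinearMap.inverse_eq h2 h1
  refine (congrArg (fun L => L (V ((natChart q).symm z))) h3).trans ?_
  exact congrArg (fun L : E × E →L[ℝ] E × E => L (fieldModel V ((natChart q).symm z)))
    (dModel_natChart ((natChart q).map_target hz))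

lemma lieBracketWithin_univ_congr {V W V' W' : E × E → E × E} {z : E × E} {s : Set (E × E)}
    (hs : s = Set.univ) (hV : ∀ᶠ z' in 𝓝 z, V z' = V' z') (hW : ∀ᶠ z' in 𝓝 z, W z' = W' z') :
    VectorField.lieBracketWithin ℝ V W s z = fderiv ℝ W' z (V' z) - fderiv ℝ V' z (W' z) := by
  rw [hs, VectorField.lieBracketWithin_univ, EventuallyEq.lieBracket_vectorField_eq hV hW,
    VectorField.lieBracket_eq]

/-- The manifold bracket is by definition the bracket of the fields pulled back to the chart,
transported by the inverse of the chart's differential; in the preferred chart at the point that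
differential is the identity. -/
lemma IsSpray.lieBracket_eq {S : FieldOn E M} (hS : IsSpray S) {w : TB E M} (hw : w ∈ slit E M) :
    fderiv ℝ (sodeE (forceE S w.proj)) (natChart w.proj w) (0, (natChart w.proj w).2)
      - fderiv ℝ (fun z : E × E => ((0 : E), z.2)) (natChart w.proj w)
        (sodeE (forceE S w.proj) (natChart w.proj w))
      = sodeE (forceE S w.proj) (natChart w.proj w) := by
  have h0 := mem_natChart_source_self w
  have h := hS.homog w hw
  have hinv : (mfderiv 𝓘(ℝ, E).tangent 𝓘(ℝ, E × E) (natChart w.proj) w :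
      E × E →L[ℝ] E × E).inverse = ContinuousLinearMap.id ℝ (E × E) := by
    have : (mfderiv 𝓘(ℝ, E).tangent 𝓘(ℝ, E × E) (natChart w.proj) w :
      E × E →L[ℝ] E × E) = ContinuousLinearMap.id ℝ (E × E) :=
      (dModel_natChart h0).trans (frame_self w)
    exact (congrArg ContinuousLinearMap.inverse this).trans ContinuousLinearMap.inverse_id
  have hV : ∀ᶠ z in 𝓝 (natChart w.proj w),
      (VectorField.mpullbackWithin 𝓘(ℝ, E × E) 𝓘(ℝ, E).tangent (natChart w.proj).symm liouville
      (Set.range 𝓘(ℝ, E).tangent) z : E × E) = ((0 : E), z.2) := by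
    filter_upwards [(isOpen_natChart_target w.proj).mem_nhds ((natChart w.proj).map_source h0)]
      with z hz
    rw [mpullbackWithin_natChart_symm liouville hz]
    refine (frame_vert ((natChart w.proj).map_target hz) ((natChart w.proj).symm z).snd).trans ?_
    have := natChart_snd w.proj ((natChart w.proj).symm z)
    rw [(natChart w.proj).right_inv hz] at this
    rw [this]
  have hSS : ∀ᶠ z in 𝓝 (natChart w.proj w),
      (VectorField.mpullbackWithin 𝓘(ℝ, E × E) 𝓘(ℝ, E).tangent (natChart w.proj).symm S
      (Set.range 𝓘(ℝ, E).tangent) z : E × E) = sodeE (forceE S w.proj) z := by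
    filter_upwards [eventually_natChart h0 (isOpen_slit.mem_nhds hw)] with z hz
    rw [mpullbackWithin_natChart_symm S hz.1, frame_eq_sodeE (hS.fst hz.2.2) hz.2.1,
      (natChart w.proj).right_inv hz.1]
  have hlie : VectorField.lieBracketWithin ℝ
      (VectorField.mpullbackWithin 𝓘(ℝ, E × E) 𝓘(ℝ, E).tangent (natChart w.proj).symm liouville
      (Set.range 𝓘(ℝ, E).tangent)) (VectorField.mpullbackWithin 𝓘(ℝ, E × E) 𝓘(ℝ, E).tangent
      (natChart w.proj).symm S (Set.range 𝓘(ℝ, E).tangent))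
      ((natChart w.proj).symm ⁻¹' Set.univ ∩ Set.range 𝓘(ℝ, E).tangent) (natChart w.proj w)
      = fieldModel S w :=
    (congrArg (fun L : E × E →L[ℝ] E × E => L _) hinv).symm.trans h
  have hlie' := (lieBracketWithin_univ_congr (by
    rw [ModelWithCorners.range_eq_univ, Set.preimage_univ, Set.inter_univ]) hV hSS).symm.trans hlie
  have hfr := frame_eq_sodeE (hS.fst hw) h0
  rw [frame_self] at hfr
  exact hlie'.trans hfr

/-- The second component of `[Δ, S] = S` is Euler's relation of degree two, but only at a point in
its own preferred chart. `quadratic_tangentMapE` moves it to the chart of `q`, so that it holds on a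
neighbourhood in one chart and can be differentiated. -/
lemma IsSpray.quadraticAt {S : FieldOn E M} (hS : IsSpray S) {w : TB E M} (hw : w ∈ slit E M)
    {q : M} (hq : w ∈ (natChart q).source) : QuadraticAt (forceE S q) (natChart q w) := by
  have key : ∀ w ∈ slit E M, ∀ q : M, w ∈ (natChart q).source →
      fderiv ℝ (forceE S q) (natChart q w) (0, (natChart q w).2)
        = (2 : ℝ) • forceE S q (natChart q w) := by
    intro w hw q hq
    have h0 := mem_natChart_source_self w
    have hS' := hS.isSode
    have h1 := congrArg Prod.snd (hS.lieBracket_eq hw)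
    rw [fderiv_sodeE (differentiableAt_of_smooth (hS'.smooth w hw _ h0)),
      (hasFDerivAt_vert _).fderiv] at h1
    have h2 : fderiv ℝ (forceE S w.proj) (natChart w.proj w) (0, (natChart w.proj w).2)
        - forceE S w.proj (natChart w.proj w) = forceE S w.proj (natChart w.proj w) := h1
    rw [← natChart_transition h0 hq]
    refine quadratic_tangentMapE (contDiffAt_transition h0 hq) (hS'.smooth w hw _ h0) ?_
      (hS'.related hw h0 hq) ((eventually_transition h0 hq).mono fun _ h => h.1) ?_
    · rw [natChart_transition h0 hq]; exact hS'.smooth w hw _ hq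
    · rw [two_smul]; exact sub_eq_iff_eq_add.1 h2
  filter_upwards [eventually_natChart hq (isOpen_slit.mem_nhds hw)] with z hz
  have := key _ hz.2.2 q hz.2.1
  rwa [(natChart q).right_inv hz.1] at this

end Sodes

/-! ### Generalized eigenvectors of rank-one perturbations. -/

section LinearAlgebra

variable {V : Type*} [AddCommGroup V] [Module ℝ V] [FiniteDimensional ℝ V]

/-- A diagonalizable endomorphism has no nontrivial generalized eigenvectors. -/
lemma sub_smul_eq_zero_of_iSup_eigenspace {A : V →ₗ[ℝ] V}
    (hA : ⨆ μ : ℝ, Module.End.eigenspace A μ = ⊤) (μ : ℝ) {y : V}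
    (hy : A (A y - μ • y) = μ • (A y - μ • y)) : A y = μ • y := by
  set N : V →ₗ[ℝ] V := A - μ • LinearMap.id with hN
  have hNy : ∀ x, N x = A x - μ • x := fun x => by simp [hN]
  -- Eigenvectors for `μ` lie in the kernel, those for `ν ≠ μ` in the range. By dimension the two
  -- subspaces then meet trivially, and `N y` lies in both.
  have hsup : LinearMap.ker N ⊔ LinearMap.range N = ⊤ := by
    rw [eq_top_iff, ← hA]
    refine iSup_le fun ν x hx => ?_
    rw [Module.End.mem_eigenspace_iff] at hx
    by_cases h : ν = μ
    · refine Submodule.mem_sup_left ?_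
      rw [LinearMap.mem_ker, hNy, hx, h, sub_self]
    · refine Submodule.mem_sup_right ⟨(ν - μ)⁻¹ • x, ?_⟩
      rw [map_smul, hNy, hx, ← sub_smul, smul_smul, inv_mul_cancel₀ (sub_ne_zero.2 h), one_smul]
  have h1 := Submodule.finrank_sup_add_finrank_inf_eq (LinearMap.ker N) (LinearMap.range N)
  have h2 := LinearMap.finrank_range_add_finrank_ker N
  rw [hsup, finrank_top] at h1
  have h3 : Module.finrank ℝ (LinearMap.ker N ⊓ LinearMap.range N : Submodule ℝ V) = 0 := by omega
  rw [Submodule.finrank_eq_zero] at h3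
  have h4 : N y ∈ LinearMap.ker N ⊓ LinearMap.range N :=
    ⟨LinearMap.mem_ker.2 (by rw [hNy (N y), hNy y, hy, sub_self]), ⟨y, rfl⟩⟩
  rw [h3, Submodule.mem_bot, hNy] at h4
  exact sub_eq_zero.1 h4

variable {A B : V →ₗ[ℝ] V} {b : V → ℝ} {t : V} {a l : ℝ}

/-- The perturbation `A + a + b ⊗ t` of a diagonalizable `A` has no nontrivial generalized
eigenvectors for nonzero eigenvalues. -/
lemma eq_zero_of_perturbed_eigenvector (hA : ⨆ μ : ℝ, Module.End.eigenspace A μ = ⊤)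
    (hB : ∀ u, B u = A u + a • u + b u • t) (hAt : A t = 0) (hBt : B t = 0) (hl : l + a ≠ 0)
    {y : V} (hy : B (B y - (l + a) • y) = (l + a) • (B y - (l + a) • y)) :
    B y = (l + a) • y := by
  set Z := B y - (l + a) • y with hZ
  have hZ' : Z = (A y - l • y) + b y • t := by rw [hZ, hB, add_smul]; abel
  have hAZ : A Z = l • Z - b Z • t := by
    rw [hB] at hy
    have : A Z = (l + a) • Z - a • Z - b Z • t := by rw [← hy]; abel
    rw [this, add_smul]; abel
  have span : ∀ c : ℝ, Z = c • t → Z = 0 := by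
    intro c hc
    have : (l + a) • Z = 0 := by rw [← hy, hc, map_smul, hBt, smul_zero]
    exact (smul_eq_zero.1 this).resolve_left hl
  suffices Z = 0 from sub_eq_zero.1 this
  have hAZ' : A Z = A (A y) - l • A y := by
    rw [hZ', map_add, map_sub, map_smul, map_smul, hAt, smul_zero, add_zero]
  -- With `N = A - l`, `A Z = N(A y)`, and applying `N` to `A Z = l Z - b(Z) t` gives `-l b(Z) t + l
  -- b(Z) t = 0`. So `N²` kills `A y`, hence `N` does.
  have h1 : A (A y) = l • A y := by
    refine sub_smul_eq_zero_of_iSup_eigenspace hA l ?_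
    rw [← hAZ']
    nth_rw 1 [hAZ]
    rw [map_sub, map_smul, map_smul, hAt, smul_zero, sub_zero]
  rw [h1, sub_self] at hAZ'
  -- Now `A Z = 0`, so `l Z = b(Z) t`. If `l ≠ 0` this puts `Z` on the line of `t`; if `l = 0` then
  -- `A y = 0` does. On that line `B = 0`, while `B Z = (l + a) Z`.
  rw [hAZ', eq_comm, sub_eq_zero] at hAZ
  by_cases h : l = 0
  · subst h
    have : A y = (0 : ℝ) • y := by
      refine sub_smul_eq_zero_of_iSup_eigenspace hA 0 ?_
      rw [zero_smul, sub_zero, h1]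
    rw [this, sub_self, zero_add] at hZ'
    exact span _ hZ'
  · refine span (l⁻¹ * b Z) ?_
    rw [mul_smul, ← hAZ, smul_smul, inv_mul_cancel₀ h, one_smul]

/-- `A x` is a multiple of `t`, so `A² x = 0` and diagonalizability gives `A x = 0`. This treats the
points where `λ = 0`. -/
lemma apply_eq_zero_of_perturbed_kernel (hA : ⨆ μ : ℝ, Module.End.eigenspace A μ = ⊤)
    (hAt : A t = 0) (ht : t ≠ 0) {x : V} (hx : A x + b x • t = 0) : A x = 0 ∧ b x = 0 := by
  have h1 : A (A x) = 0 := by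
    rw [eq_neg_of_add_eq_zero_left hx, map_neg, map_smul, hAt, smul_zero, neg_zero]
  have h2 : A x = (0 : ℝ) • x :=
    sub_smul_eq_zero_of_iSup_eigenspace hA 0 (by rw [zero_smul, sub_zero, h1, zero_smul])
  rw [zero_smul] at h2
  rw [h2, zero_add] at hx
  exact ⟨h2, (smul_eq_zero.1 hx).resolve_right ht⟩

end LinearAlgebra

/-! ### Dependence of the coordinate objects on germs only. -/

section Euclidean

variable {E : Type*} [NormedAddCommGroup E] [NormedSpace ℝ E]

lemma connE_congr {f g : E × E → E} {z : E × E} (h : f =ᶠ[𝓝 z] g) :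
    connE f =ᶠ[𝓝 z] connE g := by
  filter_upwards [h.eventuallyEq_nhds] with z' hz'
  rw [connE, connE, hz'.fderiv_eq]

lemma jacobiE_congr {f g : E × E → E} {z : E × E} (h : f =ᶠ[𝓝 z] g) :
    jacobiE f z = jacobiE g z := by
  rw [jacobiE, jacobiE, h.fderiv_eq, (connE_congr h).eq_of_nhds, (connE_congr h).fderiv_eq, sodeE,
    sodeE, h.eq_of_nhds]

lemma nablaE_congr {f g X Y : E × E → E} {z : E × E} (h : f =ᶠ[𝓝 z] g) (hX : X =ᶠ[𝓝 z] Y) :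
    nablaE f X z = nablaE g Y z := by
  rw [nablaE, nablaE, hX.fderiv_eq, hX.eq_of_nhds, (connE_congr h).eq_of_nhds, sodeE, sodeE,
    h.eq_of_nhds]

lemma QuadraticAt.congr {f g : E × E → E} {z : E × E} (hf : QuadraticAt f z) (h : f =ᶠ[𝓝 z] g) :
    QuadraticAt g z := by
  filter_upwards [hf, h.eventuallyEq_nhds] with z' h1 h2
  rw [← h2.fderiv_eq, ← h2.eq_of_nhds, h1]

end Euclidean

/-! ### Projective changes and the calculus of `∇` on the manifold. -/

section Projective

variable {E : Type*} [NormedAddCommGroup E] [NormedSpace ℝ E]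
  {M : Type*} [TopologicalSpace M] [ChartedSpace E M] [IsManifold 𝓘(ℝ, E) ∞ M]
  {S : FieldOn E M} {P : TB E M → ℝ}

lemma IsProjectiveFactor.contDiffAt (hP : IsProjectiveFactor P) {w : TB E M} (hw : w ∈ slit E M)
    {q : M} (hq : w ∈ (natChart q).source) : ContDiffAt ℝ ∞ (rep q P) (natChart q w) :=
  (contMDiffAt_iff_rep hq).1 ((hP.smooth w hw).contMDiffAt (isOpen_slit.mem_nhds hw))

lemma natChart_symm_smul (q : M) (z : E × E) (c : ℝ) :
    (natChart q).symm (z.1, c • z.2)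
      = ⟨((natChart q).symm z).proj, c • ((natChart q).symm z).snd⟩ :=
  congrArg (fun u : E => (⟨((natChart q).symm z).proj, u⟩ : TB E M))
    (map_smul (tangentCoordChange 𝓘(ℝ, E) q ((natChart q).symm z).proj
      ((natChart q).symm z).proj) c z.2)

/-- Differentiate `P(cv) = c P(v)` at `c = 1`; natural charts are linear on fibres, so scaling `v`
scales `ẋ`. -/
lemma IsProjectiveFactor.euler (hP : IsProjectiveFactor P) {w : TB E M} (hw : w ∈ slit E M)
    {q : M} (hq : w ∈ (natChart q).source) :
    ∀ᶠ z in 𝓝 (natChart q w), fderiv ℝ (rep q P) z (0, z.2) = rep q P z := by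
  filter_upwards [eventually_natChart hq (isOpen_slit.mem_nhds hw)] with z hz
  have hd := differentiableAt_of_smooth (hP.contDiffAt hz.2.2 hz.2.1)
  rw [(natChart q).right_inv hz.1] at hd
  have hc : HasDerivAt (fun c : ℝ => (z.1, c • z.2)) ((0 : E), z.2) 1 := by
    have := (hasDerivAt_const (1 : ℝ) z.1).prodMk ((hasDerivAt_id (1 : ℝ)).smul_const z.2)
    simpa using this
  have h1 : HasDerivAt (fun c : ℝ => rep q P (z.1, c • z.2)) (fderiv ℝ (rep q P) z (0, z.2)) 1 := by
    refine HasFDerivAt.comp_hasDerivAt (l := rep q P) (1 : ℝ) ?_ hc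
    simpa using hd.hasFDerivAt
  have h2 : (fun c : ℝ => rep q P (z.1, c • z.2)) =ᶠ[𝓝 1] fun c => c * rep q P z := by
    filter_upwards [lt_mem_nhds (zero_lt_one (α := ℝ))] with c hc0
    rw [rep, Function.comp_apply, natChart_symm_smul]
    exact hP.homog _ hz.2.2 c hc0
  have h3 := (hasDerivAt_id (1 : ℝ)).mul_const (rep q P z)
  exact h1.unique (HasDerivAt.congr_of_eventuallyEq (by simpa using h3) h2)

/-- The canonical vector field along the projection, with the tangent spaces of `M` identified with
the model space. -/
def canonModel (w : TB E M) : E := w.snd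

lemma natChart_snd_eq (q : M) (w : TB E M) : (natChart q w).2 = baseFrame q w (canonModel w) :=
  natChart_snd q w

lemma natChart_self_snd_eq (w : TB E M) : (natChart w.proj w).2 = canonModel w :=
  natChart_self_snd w

lemma fieldModel_projChange (w : TB E M) : fieldModel (projChange S P) w
    = fieldModel S w - (2 * P w) • ((0 : E), canonModel w) := rfl

lemma forceE_projChange {q : M} {z : E × E} (hz : z ∈ (natChart q).target) :
    forceE (projChange S P) q z = changeE (forceE S q) (rep q P) z := by
  have hq := (natChart q).map_target hz
  have h1 := force_eq (S := projChange S P) hq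
  have h2 := force_eq (S := S) hq
  have h3 : natChart q ((natChart q).symm z) = z := (natChart q).right_inv hz
  rw [fieldModel_projChange, map_sub, map_smul, Prod.snd_sub, ← h2] at h1
  refine h1.trans ?_
  rw [changeE]
  rw [Prod.smul_snd, frame_vert hq, ← natChart_snd_eq, h3]
  rfl

lemma forceE_projChange_eventuallyEq {q : M} {w : TB E M} (hq : w ∈ (natChart q).source) :
    changeE (forceE S q) (rep q P) =ᶠ[𝓝 (natChart q w)] forceE (projChange S P) q := by
  filter_upwards [(isOpen_natChart_target q).mem_nhds ((natChart q).map_source hq)] with z hz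
  exact (forceE_projChange hz).symm

/-- Only `IsSode` and the infinitesimal homogeneity in charts are used for `S̃`, so neither its
smoothness as a section of `TTM` nor its bracket with `Δ` has to be established. -/
lemma IsSode.projChange (hS : IsSode S) (hP : IsProjectiveFactor P) :
    IsSode (projChange S P) := by
  refine ⟨fun w hw => ?_, fun w hw q hq => ?_⟩
  · refine Eq.trans ?_ (hS.fst w hw)
    rw [fieldModel_projChange]
    simp
  · exact (contDiffAt_changeE (hS.smooth w hw q hq) (hP.contDiffAt hw hq)).congr_of_eventuallyEq
      (forceE_projChange_eventuallyEq hq).symm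

lemma IsSpray.quadraticAt_projChange (hS : IsSpray S) (hP : IsProjectiveFactor P) {w : TB E M}
    (hw : w ∈ slit E M) {q : M} (hq : w ∈ (natChart q).source) :
    QuadraticAt (forceE (SprayGeom.projChange S P) q) (natChart q w) :=
  (QuadraticAt.changeE (hS.isSode.smooth w hw q hq) (hS.quadraticAt hw hq) (hP.contDiffAt hw hq)
    (hP.euler hw hq)).congr (forceE_projChange_eventuallyEq hq)

/-- `bForm`, with the tangent spaces of `M` identified with the model space. -/
def bModel (S : FieldOn E M) (P : TB E M → ℝ) (w : TB E M) : E →L[ℝ] ℝ := bForm S P w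

/-- `dV`, with the tangent spaces of `M` identified with the model space. -/
def dVModel (g : TB E M → ℝ) (w : TB E M) : E →L[ℝ] ℝ := dV g w

lemma dVModel_apply {w : TB E M} {g : TB E M → ℝ}
    (hg : DifferentiableAt ℝ (rep w.proj g) (natChart w.proj w)) (u : E) :
    dVModel g w u = fderiv ℝ (rep w.proj g) (natChart w.proj w) (0, u) :=
  congrArg (fun L : E × E →L[ℝ] ℝ => L (0, u)) (dModel_self hg)

lemma rep_lieD_eventuallyEq (hS : IsSode S) (hP : IsProjectiveFactor P) {w : TB E M}
    (hw : w ∈ slit E M) {q : M} (hq : w ∈ (natChart q).source) :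
    rep q (lieD S P) =ᶠ[𝓝 (natChart q w)]
      fun z => fderiv ℝ (rep q P) z (sodeE (forceE S q) z) := by
  filter_upwards [eventually_natChart hq (isOpen_slit.mem_nhds hw)] with z hz
  have := lieD_eq (hS.fst _ hz.2.2) hz.2.1
    (differentiableAt_of_smooth (hP.contDiffAt hz.2.2 hz.2.1))
  rw [(natChart q).right_inv hz.1] at this
  exact this

lemma contDiffAt_rep_lieD (hS : IsSode S) (hP : IsProjectiveFactor P) {w : TB E M}
    (hw : w ∈ slit E M) {q : M} (hq : w ∈ (natChart q).source) :
    ContDiffAt ℝ ∞ (rep q (lieD S P)) (natChart q w) :=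
  ((contDiffAt_fderiv (hP.contDiffAt hw hq)).clm_apply
    (contDiffAt_sodeE (hS.smooth w hw q hq))).congr_of_eventuallyEq
    (rep_lieD_eventuallyEq hS hP hw hq)

lemma bModel_eq (hS : IsSode S) (hP : IsProjectiveFactor P) {w : TB E M} (hw : w ∈ slit E M)
    (u : E) : bModel S P w u
      = bFormE (forceE S w.proj) (rep w.proj P) (natChart w.proj w) u := by
  have h0 := mem_natChart_source_self w
  have hP0 := differentiableAt_of_smooth (hP.contDiffAt hw h0)
  have h1 : bModel S P w u = 3 * dModel P w (u, -connE (forceE S w.proj) (natChart w.proj w) u)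
      - P w * dVModel P w u - dVModel (lieD S P) w u := rfl
  rw [h1, dModel_self hP0, dVModel_apply hP0,
    dVModel_apply (differentiableAt_of_smooth (contDiffAt_rep_lieD hS hP hw h0)),
    (rep_lieD_eventuallyEq hS hP hw h0).fderiv_eq, bFormE, rep_natChart h0]

lemma jacobiModel_projChange (hS : IsSpray S) (hP : IsProjectiveFactor P) {w : TB E M}
    (hw : w ∈ slit E M) (u : E) :
    jacobiModel (projChange S P) w u
      = jacobiModel S w u + aFun S P w • u + bModel S P w u • canonModel w := by
  have h0 := mem_natChart_source_self w
  have hS' := hS.isSode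
  have hT := hS'.projChange hP
  have hP0 := hP.contDiffAt hw h0
  rw [jacobiModel_self (hT.fst w hw) (hT.smooth w hw _ h0),
    jacobiModel_self (hS'.fst w hw) (hS'.smooth w hw _ h0), bModel_eq hS' hP hw,
    ← jacobiE_congr (forceE_projChange_eventuallyEq h0),
    jacobiE_changeE (hS'.smooth w hw _ h0) (hS.quadraticAt hw h0) hP0 (hP.euler hw h0),
    rep_natChart h0, natChart_self_snd_eq, aFun,
    lieD_eq (hS'.fst w hw) h0 (differentiableAt_of_smooth hP0)]

lemma jacobiModel_snd (hS : IsSode S) {w : TB E M} (hw : w ∈ slit E M)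
    (hq : QuadraticAt (forceE S w.proj) (natChart w.proj w)) :
    jacobiModel S w (canonModel w) = 0 := by
  have h0 := mem_natChart_source_self w
  rw [jacobiModel_self (hS.fst w hw) (hS.smooth w hw _ h0), ← natChart_self_snd_eq,
    hq.jacobiE_snd (hS.smooth w hw _ h0)]

/-! ### Calculus of the dynamical covariant derivative -/

lemma eventually_rep_eq {V : Type*} {w : TB E M} {g h : TB E M → V} (hgh : ∀ᶠ v in 𝓝 w, g v = h v)
    {q : M} (hq : w ∈ (natChart q).source) : rep q g =ᶠ[𝓝 (natChart q w)] rep q h := by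
  filter_upwards [eventually_natChart hq hgh] with z hz
  exact hz.2.2

lemma compt_congr {w : TB E M} {X Y : TB E M → E} (h : ∀ᶠ v in 𝓝 w, X v = Y v) {q : M}
    (hq : w ∈ (natChart q).source) : compt q X =ᶠ[𝓝 (natChart q w)] compt q Y :=
  eventually_rep_eq (h.mono fun v hv => by rw [hv]) hq

lemma nablaModel_congr {w : TB E M} (hfst : (fieldModel S w).1 = w.snd) {X Y : TB E M → E}
    (h : ∀ᶠ v in 𝓝 w, X v = Y v)
    (hX : DifferentiableAt ℝ (compt w.proj X) (natChart w.proj w)) :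
    nablaModel S X w = nablaModel S Y w := by
  have hc := compt_congr h (mem_natChart_source_self w)
  rw [nablaModel_self hfst hX, nablaModel_self hfst (hc.differentiableAt_iff.1 hX)]
  exact nablaE_congr EventuallyEq.rfl hc

lemma compt_add (q : M) (X Y : TB E M → E) :
    compt q (fun v => X v + Y v) = fun z => compt q X z + compt q Y z := by
  funext z; simp [compt, rep]

lemma compt_smul (q : M) (g : TB E M → ℝ) (X : TB E M → E) :
    compt q (fun v => g v • X v) = fun z => rep q g z • compt q X z := by
  funext z; simp [compt, rep]

lemma compt_snd_eventuallyEq {q : M} {w : TB E M} (hq : w ∈ (natChart q).source) :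
    compt q (fun v : TB E M => canonModel v) =ᶠ[𝓝 (natChart q w)] Prod.snd := by
  filter_upwards [(isOpen_natChart_target q).mem_nhds ((natChart q).map_source hq)] with z hz
  exact (natChart_snd q ((natChart q).symm z)).symm.trans
    (congrArg Prod.snd ((natChart q).right_inv hz))

lemma nablaModel_add {w : TB E M} (hfst : (fieldModel S w).1 = w.snd) {X Y : TB E M → E}
    (hX : DifferentiableAt ℝ (compt w.proj X) (natChart w.proj w))
    (hY : DifferentiableAt ℝ (compt w.proj Y) (natChart w.proj w)) :
    nablaModel S (fun v => X v + Y v) w = nablaModel S X w + nablaModel S Y w := by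
  have hXY : DifferentiableAt ℝ (compt w.proj (fun v => X v + Y v)) (natChart w.proj w) := by
    rw [compt_add]; exact hX.add hY
  rw [nablaModel_self hfst hXY, nablaModel_self hfst hX, nablaModel_self hfst hY, compt_add,
    nablaE, nablaE, nablaE, fderiv_fun_add hX hY, map_add, add_apply]
  abel

lemma nablaModel_smul {w : TB E M} (hfst : (fieldModel S w).1 = w.snd) {g : TB E M → ℝ}
    {X : TB E M → E} (hg : DifferentiableAt ℝ (rep w.proj g) (natChart w.proj w))
    (hX : DifferentiableAt ℝ (compt w.proj X) (natChart w.proj w)) :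
    nablaModel S (fun v => g v • X v) w = lieD S g w • X w + g w • nablaModel S X w := by
  have h0 := mem_natChart_source_self w
  have hgX : DifferentiableAt ℝ (compt w.proj (fun v => g v • X v)) (natChart w.proj w) := by
    rw [compt_smul]; exact hg.smul hX
  rw [nablaModel_self hfst hgX, nablaModel_self hfst hX, compt_smul, lieD_eq hfst h0 hg,
    nablaE, nablaE, fderiv_fun_smul hg hX, rep_natChart h0, compt_self, map_smul, smul_add]
  simp only [add_apply, smul_apply, ContinuousLinearMap.smulRight_apply]
  abel

lemma nablaModel_snd (hS : IsSode S) {w : TB E M} (hw : w ∈ slit E M)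
    (hq : QuadraticAt (forceE S w.proj) (natChart w.proj w)) :
    nablaModel S (fun v : TB E M => canonModel v) w = 0 := by
  have hc := compt_snd_eventuallyEq (mem_natChart_source_self w)
  rw [nablaModel_self (hS.fst w hw) (hc.differentiableAt_iff.2 differentiableAt_snd),
    nablaE_congr EventuallyEq.rfl hc, hq.nablaE_snd]

lemma lieD_mul {w : TB E M} (hfst : (fieldModel S w).1 = w.snd) {g h : TB E M → ℝ}
    (hg : DifferentiableAt ℝ (rep w.proj g) (natChart w.proj w))
    (hh : DifferentiableAt ℝ (rep w.proj h) (natChart w.proj w)) :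
    lieD S (fun v => g v * h v) w = lieD S g w * h w + g w * lieD S h w := by
  have h0 := mem_natChart_source_self w
  have e : rep w.proj (fun v => g v * h v) = fun z => rep w.proj g z * rep w.proj h z := rfl
  rw [lieD_eq hfst h0 (by rw [e]; exact hg.mul hh), lieD_eq hfst h0 hg, lieD_eq hfst h0 hh, e,
    fderiv_fun_mul hg hh, rep_natChart h0, rep_natChart h0]
  simp only [add_apply, smul_apply, smul_eq_mul]
  ring

lemma lieD_congr {w : TB E M} (hfst : (fieldModel S w).1 = w.snd) {g h : TB E M → ℝ}
    (hg : DifferentiableAt ℝ (rep w.proj g) (natChart w.proj w)) (hgh : ∀ᶠ v in 𝓝 w, g v = h v) :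
    lieD S g w = lieD S h w := by
  have h0 := mem_natChart_source_self w
  have e := eventually_rep_eq hgh h0
  rw [lieD_eq hfst h0 hg, lieD_eq hfst h0 (e.differentiableAt_iff.1 hg), e.fderiv_eq]

/-- The derivative of a field along the projection in the direction of the Liouville field. -/
def vertD (X : TB E M → E) (w : TB E M) : E :=
  fderiv ℝ (compt w.proj X) (natChart w.proj w) (0, (natChart w.proj w).2)

lemma nablaModel_projChange (hS : IsSode S) (hP : IsProjectiveFactor P) {w : TB E M}
    (hw : w ∈ slit E M) {X : TB E M → E}
    (hX : DifferentiableAt ℝ (compt w.proj X) (natChart w.proj w)) :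
    nablaModel (projChange S P) X w = nablaModel S X w - (2 * P w) • vertD X w + P w • X w
      + dVModel P w (X w) • canonModel w := by
  have h0 := mem_natChart_source_self w
  have hP0 := differentiableAt_of_smooth (hP.contDiffAt hw h0)
  rw [nablaModel_self ((hS.projChange hP).fst w hw) hX, nablaModel_self (hS.fst w hw) hX,
    ← nablaE_congr (forceE_projChange_eventuallyEq h0) EventuallyEq.rfl,
    nablaE_changeE (differentiableAt_of_smooth (hS.smooth w hw _ h0)) hP0, dVModel_apply hP0,
    rep_natChart h0, compt_self, vertD, natChart_self_snd_eq]

/-- The vertical derivative of an eigenfield is an eigenfield up to a multiple of the field. -/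
lemma exists_jacobiModel_vertD (hS : IsSode S) {U : Set (TB E M)} (hU : IsOpen U)
    (hUs : U ⊆ slit E M) {w : TB E M} (hw : w ∈ U)
    (hq : QuadraticAt (forceE S w.proj) (natChart w.proj w)) {X : TB E M → E}
    (hX : SmoothAlong U X) {l : TB E M → ℝ}
    (hl : DifferentiableAt ℝ (rep w.proj l) (natChart w.proj w))
    (he : ∀ v ∈ U, jacobiModel S v (X v) = l v • X v) :
    ∃ c : ℝ, jacobiModel S w (vertD X w) - l w • vertD X w = c • X w := by
  have h0 := mem_natChart_source_self w
  have hXw := SmoothAlong.contDiffAt hU hX hw h0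
  have hS0 := hS.smooth w (hUs hw) _ h0
  have hev : (fun z => jacobiE (forceE S w.proj) z (compt w.proj X z)) =ᶠ[𝓝 (natChart w.proj w)]
      fun z => rep w.proj l z • compt w.proj X z := by
    filter_upwards [eventually_natChart h0 (hU.mem_nhds hw)] with z hz
    have := (hS.nabla_jacobi_eq (hUs hz.2.2) hz.2.1 (X := X) fun p hp =>
      differentiableAt_of_smooth (SmoothAlong.contDiffAt hU hX hz.2.2 hp)).2
    rw [(natChart w.proj).right_inv hz.1, he _ hz.2.2, map_smul] at this
    exact this.symm
  have h1 := congrArg (fun L : E × E →L[ℝ] E => L (0, (natChart w.proj w).2)) hev.fderiv_eq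
  rw [fderiv_clm_apply (differentiableAt_of_smooth (contDiffAt_jacobiE hS0))
    (differentiableAt_of_smooth hXw), fderiv_fun_smul hl (differentiableAt_of_smooth hXw)] at h1
  simp only [add_apply, smul_apply, ContinuousLinearMap.comp_apply,
    ContinuousLinearMap.flip_apply, ContinuousLinearMap.smulRight_apply] at h1
  rw [hq.fderiv_jacobiE_vert hS0 (hS.eventually (hUs hw) h0), smul_apply,
    ← jacobiModel_self (hS.fst w (hUs hw)) hS0, compt_self, he w hw, rep_natChart h0] at h1
  -- The derivative of `Φ(X) = lX` along `Δ` is `2lX + Φ(∂_Δ X) = Δ(l)X + l ∂_Δ X`, so the multiple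
  -- is `Δ(l) - 2l`.
  refine ⟨fderiv ℝ (rep w.proj l) (natChart w.proj w) (0, (natChart w.proj w).2) - 2 * l w, ?_⟩
  rw [sub_smul, mul_smul]
  change jacobiModel S w (vertD X w) + _ = l w • vertD X w + _ at h1
  rw [sub_eq_sub_iff_add_eq_add, h1, add_comm]

end Projective

/-! ### Eigenfields, their defects and the shift. -/

section Eigenfields

variable {E : Type*} [NormedAddCommGroup E] [NormedSpace ℝ E]
  {M : Type*} [TopologicalSpace M] [ChartedSpace E M] [IsManifold 𝓘(ℝ, E) ∞ M]
  {S : FieldOn E M} {P l : TB E M → ℝ} {U : Set (TB E M)} {X Y : TB E M → E}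

lemma SmoothAlong.add_smul (hU : IsOpen U) (hX : SmoothAlong U X) (hY : SmoothAlong U Y)
    {g : TB E M → ℝ} (hg : ContMDiffOn 𝓘(ℝ, E).tangent 𝓘(ℝ, ℝ) ∞ g U) :
    SmoothAlong U (fun v => X v + g v • Y v) := by
  refine smoothAlong_of_contDiffAt fun w hw => ?_
  have h0 := mem_natChart_source_self w
  rw [compt_add w.proj X (fun v => g v • Y v), compt_smul]
  exact (SmoothAlong.contDiffAt hU hX hw h0).add
    (((contMDiffAt_iff_rep h0).1 ((hg w hw).contMDiffAt (hU.mem_nhds hw))).smul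
      (SmoothAlong.contDiffAt hU hY hw h0))

lemma SmoothAlong.congr (hX : SmoothAlong U X) (h : ∀ v ∈ U, X v = Y v) : SmoothAlong U Y :=
  fun w hw => (hX w hw).congr
    (fun v hv => congrArg (fun u : E => (⟨v.proj, u⟩ : TB E M)) (h v hv).symm)
    (congrArg (fun u : E => (⟨w.proj, u⟩ : TB E M)) (h w hw).symm)

lemma smoothAlong_zero : SmoothAlong U (fun _ : TB E M => (0 : E)) := by
  refine smoothAlong_of_contDiffAt fun w _ => ?_
  have : compt w.proj (fun _ : TB E M => (0 : E)) = fun _ => 0 := by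
    funext z; simp [compt, rep]
  rw [this]
  exact contDiffAt_const

lemma SmoothAlong.smul (hU : IsOpen U) (hX : SmoothAlong U X)
    {g : TB E M → ℝ} (hg : ContMDiffOn 𝓘(ℝ, E).tangent 𝓘(ℝ, ℝ) ∞ g U) :
    SmoothAlong U (fun v => g v • X v) := by
  have := SmoothAlong.add_smul hU smoothAlong_zero hX hg
  simp only [zero_add] at this
  exact this

lemma smoothAlong_canonModel : SmoothAlong U (canonModel : TB E M → E) := by
  refine smoothAlong_of_contDiffAt fun w _ => ?_
  exact contDiffAt_snd.congr_of_eventuallyEq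
    (compt_snd_eventuallyEq (mem_natChart_source_self w))

/-- A smooth field along the projection vanishes on the closure of a set where it vanishes. -/
lemma SmoothAlong.eq_zero_of_mem_closure (hU : IsOpen U) (hX : SmoothAlong U X)
    {V : Set (TB E M)} (hV : ∀ v ∈ V, X v = 0) {w : TB E M} (hw : w ∈ U) (hwV : w ∈ closure V) :
    X w = 0 := by
  have h0 := mem_natChart_source_self w
  have h1 : ContinuousAt (compt w.proj X ∘ natChart w.proj) w :=
    (SmoothAlong.contDiffAt hU hX hw h0).continuousAt.comp (continuousAt_natChart h0)
  by_contra hne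
  have h2 : (compt w.proj X ∘ natChart w.proj) w ≠ 0 := by
    rwa [Function.comp_apply, compt_self]
  obtain ⟨v, ⟨hv1, hv2⟩, hv3⟩ := mem_closure_iff_nhds.1 hwV _
    ((h1.eventually_ne h2).and ((isOpen_natChart_source w.proj).mem_nhds h0))
  apply hv1
  rw [Function.comp_apply, compt_natChart hv2, hV v hv3, map_zero]

/-- A function is smooth if its multiple of the canonical field is. -/
lemma contMDiffOn_of_smoothAlong_smul_canonModel (hU : IsOpen U) (hUs : U ⊆ slit E M)
    {g : TB E M → ℝ} (hg : SmoothAlong U (fun v => g v • canonModel v)) :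
    ContMDiffOn 𝓘(ℝ, E).tangent 𝓘(ℝ, ℝ) ∞ g U := by
  intro w hw
  have h0 := mem_natChart_source_self w
  refine ((contMDiffAt_iff_rep h0).2 ?_).contMDiffWithinAt
  have hne : (natChart w.proj w).2 ≠ 0 := by rw [natChart_self_snd_eq]; exact hUs hw
  obtain ⟨φ, hφ⟩ := SeparatingDual.exists_ne_zero (R := ℝ) hne
  have h1 := SmoothAlong.contDiffAt hU hg hw h0
  rw [compt_smul] at h1
  have h2 : ContDiffAt ℝ ∞ (fun z : E × E => φ z.2) (natChart w.proj w) :=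
    φ.contDiff.contDiffAt.comp _ contDiffAt_snd
  refine ((φ.contDiff.contDiffAt.comp _ h1).div h2 hφ).congr_of_eventuallyEq ?_
  filter_upwards [compt_snd_eventuallyEq h0, h2.continuousAt.eventually_ne hφ] with z hz hz2
  have hz' : compt w.proj canonModel z = z.2 := hz
  change rep w.proj g z = φ (rep w.proj g z • compt w.proj canonModel z) / φ z.2
  rw [hz', map_smul, smul_eq_mul, mul_div_assoc, div_self hz2, mul_one]

/-- `b(X) T = Φ̃(X) - Φ(X) - aX` is smooth, and `T` vanishes nowhere on the slit bundle; no
regularity of `b` itself is needed. -/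
lemma smooth_bModel (hS : IsSpray S) (hP : IsProjectiveFactor P) (hU : IsOpen U)
    (hUs : U ⊆ slit E M) (ha : ContMDiffOn 𝓘(ℝ, E).tangent 𝓘(ℝ, ℝ) ∞ (aFun S P) U)
    (hX : SmoothAlong U X) :
    ContMDiffOn 𝓘(ℝ, E).tangent 𝓘(ℝ, ℝ) ∞ (fun v => bModel S P v (X v)) U := by
  refine contMDiffOn_of_smoothAlong_smul_canonModel hU hUs ?_
  have h1 := (hS.isSode.smoothAlong_nabla_jacobi hU hUs hX).2
  have h2 := ((hS.isSode.projChange hP).smoothAlong_nabla_jacobi hU hUs hX).2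
  have h3 := SmoothAlong.add_smul hU (SmoothAlong.add_smul hU h2 h1
    (contMDiffOn_const (c := (-1 : ℝ)))) hX ha.neg
  refine SmoothAlong.congr h3 fun v hv => ?_
  rw [jacobiModel_projChange hS hP (hUs hv)]
  module

lemma smooth_aFun (hS : IsSode S) (hP : IsProjectiveFactor P) (hUs : U ⊆ slit E M) :
    ContMDiffOn 𝓘(ℝ, E).tangent 𝓘(ℝ, ℝ) ∞ (aFun S P) U := by
  intro w hw
  have h0 := mem_natChart_source_self w
  refine ((contMDiffAt_iff_rep h0).2 ?_).contMDiffWithinAt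
  exact ((hP.contDiffAt (hUs hw) h0).pow 2).sub (contDiffAt_rep_lieD hS hP (hUs hw) h0)

/-- The defect `Φ(∇X) - l ∇X` of the covariant derivative of an eigenfield `X`. -/
def defect (S : FieldOn E M) (l : TB E M → ℝ) (X : TB E M → E) (w : TB E M) : E :=
  jacobiModel S w (nablaModel S X w) - l w • nablaModel S X w

lemma smoothAlong_defect (hS : IsSode S) (hU : IsOpen U) (hUs : U ⊆ slit E M)
    (hl : ContMDiffOn 𝓘(ℝ, E).tangent 𝓘(ℝ, ℝ) ∞ l U) (hX : SmoothAlong U X) :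
    SmoothAlong U (defect S l X) := by
  have h1 := (hS.smoothAlong_nabla_jacobi hU hUs hX).1
  have h2 := SmoothAlong.add_smul hU (hS.smoothAlong_nabla_jacobi hU hUs h1).2 h1 hl.neg
  have : defect S l X = fun v => jacobiModel S v (nablaModel S X v)
      + (-l) v • nablaModel S X v := by
    funext v
    rw [defect, Pi.neg_apply, neg_smul, sub_eq_add_neg]
  rw [this]
  exact h2

lemma differentiableAt_rep (hU : IsOpen U) {g : TB E M → ℝ}
    (hg : ContMDiffOn 𝓘(ℝ, E).tangent 𝓘(ℝ, ℝ) ∞ g U) {w : TB E M} (hw : w ∈ U) :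
    DifferentiableAt ℝ (rep w.proj g) (natChart w.proj w) :=
  differentiableAt_of_smooth ((contMDiffAt_iff_rep (mem_natChart_source_self w)).1
    ((hg w hw).contMDiffAt (hU.mem_nhds hw)))

lemma differentiableAt_compt (hU : IsOpen U) (hX : SmoothAlong U X) {w : TB E M} (hw : w ∈ U) :
    DifferentiableAt ℝ (compt w.proj X) (natChart w.proj w) :=
  differentiableAt_of_smooth (SmoothAlong.contDiffAt hU hX hw (mem_natChart_source_self w))

/-- The term `S(g)X` of the Leibniz rule is killed by `Φ - l`, so the defect is tensorial on
eigenfields. This permits multiplication by `λ` and by bump functions. -/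
lemma defect_smul (hS : IsSode S) (hU : IsOpen U) (hUs : U ⊆ slit E M) (hX : SmoothAlong U X)
    {g : TB E M → ℝ} (hg : ContMDiffOn 𝓘(ℝ, E).tangent 𝓘(ℝ, ℝ) ∞ g U) {w : TB E M} (hw : w ∈ U)
    (he : jacobiModel S w (X w) = l w • X w) :
    defect S l (fun v => g v • X v) w = g w • defect S l X w := by
  rw [defect, defect, nablaModel_smul (hS.fst w (hUs hw)) (differentiableAt_rep hU hg hw)
    (differentiableAt_compt hU hX hw), map_add, map_smul, map_smul, he]
  module

lemma defect_congr (hS : IsSode S) (hU : IsOpen U) (hUs : U ⊆ slit E M) (hX : SmoothAlong U X)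
    {w : TB E M} (hw : w ∈ U) (h : ∀ v ∈ U, X v = Y v) : defect S l X w = defect S l Y w := by
  rw [defect, defect, nablaModel_congr (hS.fst w (hUs hw))
    (Filter.eventually_of_mem (hU.mem_nhds hw) h) (differentiableAt_compt hU hX hw)]

/-- `bracketNablaJacobi`, with the tangent spaces of `M` identified with the model space. -/
def bracketModel (S : FieldOn E M) (X : TB E M → E) (w : TB E M) : E := bracketNablaJacobi S X w

/-- On eigenfields, `[∇Φ, Φ]` is the square of `Φ - l` applied to `∇X`. -/
lemma bracketModel_eq (hS : IsSode S) (hU : IsOpen U) (hUs : U ⊆ slit E M)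
    (hl : ContMDiffOn 𝓘(ℝ, E).tangent 𝓘(ℝ, ℝ) ∞ l U) (hX : SmoothAlong U X)
    (he : ∀ v ∈ U, jacobiModel S v (X v) = l v • X v) {w : TB E M} (hw : w ∈ U) :
    bracketModel S X w
      = jacobiModel S w (defect S l X w) - l w • defect S l X w := by
  have e0 : bracketModel S X w
      = (nablaModel S (fun v => jacobiModel S v (jacobiModel S v (X v))) w
        - jacobiModel S w (nablaModel S (fun v => jacobiModel S v (X v)) w))
        - jacobiModel S w (nablaModel S (fun v => jacobiModel S v (X v)) w
          - jacobiModel S w (nablaModel S X w)) := rfl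
  have hfst := hS.fst w (hUs hw)
  have hlX := SmoothAlong.smul hU hX hl
  have hllX := SmoothAlong.smul hU hlX hl
  have hn1 : nablaModel S (fun v => jacobiModel S v (X v)) w
      = lieD S l w • X w + l w • nablaModel S X w := by
    rw [← nablaModel_smul hfst (differentiableAt_rep hU hl hw) (differentiableAt_compt hU hX hw)]
    exact (nablaModel_congr hfst (Filter.eventually_of_mem (hU.mem_nhds hw)
      fun v hv => (he v hv).symm) (differentiableAt_compt hU hlX hw)).symm
  have hn2 : nablaModel S (fun v => jacobiModel S v (jacobiModel S v (X v))) w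
      = lieD S l w • (l w • X w) + l w • (lieD S l w • X w + l w • nablaModel S X w) := by
    rw [← nablaModel_smul hfst (differentiableAt_rep hU hl hw) (differentiableAt_compt hU hX hw),
      ← nablaModel_smul hfst (differentiableAt_rep hU hl hw) (differentiableAt_compt hU hlX hw)]
    exact (nablaModel_congr hfst (Filter.eventually_of_mem (hU.mem_nhds hw)
      fun v hv => by rw [he v hv, map_smul, he v hv])
      (differentiableAt_compt hU hllX hw)).symm
  -- The terms with `S(l)X` cancel, leaving `l²∇X - 2lΦ(∇X) + Φ²(∇X)`.
  rw [e0, hn1, hn2, defect]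
  simp only [map_add, map_sub, map_smul, he w hw]
  module

/-- Diagonalizability on `U`, with the tangent spaces identified with the model space. -/
def DiagModelOn (U : Set (TB E M)) (S : FieldOn E M) : Prop :=
  ∀ v ∈ U, ⨆ μ : ℝ, Module.End.eigenspace (jacobiModel S v : E →ₗ[ℝ] E) μ = ⊤

lemma IsSpray.jacobiModel_canonModel (hS : IsSpray S) {w : TB E M} (hw : w ∈ slit E M) :
    jacobiModel S w (canonModel w) = 0 :=
  jacobiModel_snd hS.isSode hw (hS.quadraticAt hw (mem_natChart_source_self w))

lemma IsSpray.jacobiModel_projChange_canonModel (hS : IsSpray S) (hP : IsProjectiveFactor P)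
    {w : TB E M} (hw : w ∈ slit E M) :
    jacobiModel (SprayGeom.projChange S P) w (canonModel w) = 0 :=
  jacobiModel_snd (hS.isSode.projChange hP) hw
    (hS.quadraticAt_projChange hP hw (mem_natChart_source_self w))

/-- Evaluate `Φ̃ = Φ + a·id + b ⊗ T` on `T`, which both `Φ` and `Φ̃` annihilate. -/
lemma bModel_canonModel (hS : IsSpray S) (hP : IsProjectiveFactor P) {w : TB E M}
    (hw : w ∈ slit E M) : bModel S P w (canonModel w) = -aFun S P w := by
  have h := jacobiModel_projChange hS hP hw (canonModel w)
  rw [hS.jacobiModel_canonModel hw, hS.jacobiModel_projChange_canonModel hP hw, zero_add,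
    ← add_smul, eq_comm, smul_eq_zero, or_iff_left (show canonModel w ≠ 0 from hw)] at h
  linarith

lemma dVModel_canonModel (hP : IsProjectiveFactor P) {w : TB E M} (hw : w ∈ slit E M) :
    dVModel P w (canonModel w) = P w := by
  have h0 := mem_natChart_source_self w
  rw [dVModel_apply (differentiableAt_of_smooth (hP.contDiffAt hw h0)), ← natChart_self_snd_eq,
    (hP.euler hw h0).self_of_nhds, rep_natChart h0]

/-- The field `X + (b(X) / l) T`. -/
def shift (S : FieldOn E M) (P l : TB E M → ℝ) (X : TB E M → E) (v : TB E M) : E :=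
  X v + (bModel S P v (X v) / l v) • canonModel v

lemma smooth_shift_coeff (hS : IsSpray S) (hP : IsProjectiveFactor P) (hU : IsOpen U)
    (hUs : U ⊆ slit E M) (hl : ContMDiffOn 𝓘(ℝ, E).tangent 𝓘(ℝ, ℝ) ∞ l U)
    (hne : ∀ v ∈ U, l v ≠ 0) (hX : SmoothAlong U X) :
    ContMDiffOn 𝓘(ℝ, E).tangent 𝓘(ℝ, ℝ) ∞ (fun v => bModel S P v (X v) / l v) U := by
  have hb := smooth_bModel hS hP hU hUs (smooth_aFun hS.isSode hP hUs) hX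
  intro w hw
  have h0 := mem_natChart_source_self w
  refine ((contMDiffAt_iff_rep h0).2 ?_).contMDiffWithinAt
  refine ((contMDiffAt_iff_rep h0).1 ((hb w hw).contMDiffAt (hU.mem_nhds hw))).div
    ((contMDiffAt_iff_rep h0).1 ((hl w hw).contMDiffAt (hU.mem_nhds hw))) ?_
  change l ((natChart w.proj).symm (natChart w.proj w)) ≠ 0
  rw [(natChart w.proj).left_inv h0]
  exact hne w hw

lemma smoothAlong_shift (hS : IsSpray S) (hP : IsProjectiveFactor P) (hU : IsOpen U)
    (hUs : U ⊆ slit E M) (hl : ContMDiffOn 𝓘(ℝ, E).tangent 𝓘(ℝ, ℝ) ∞ l U)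
    (hne : ∀ v ∈ U, l v ≠ 0) (hX : SmoothAlong U X) : SmoothAlong U (shift S P l X) :=
  SmoothAlong.add_smul hU hX smoothAlong_canonModel
    (smooth_shift_coeff hS hP hU hUs hl hne hX)

/-- Adding a multiple of `T` does not change `Φ̃(X) = λ̃X + b(X)T`; the coefficient `b(X)/λ̃` is the
one making this `λ̃` times the shifted field. -/
lemma jacobiModel_shift (hS : IsSpray S) (hP : IsProjectiveFactor P) {lam : TB E M → ℝ}
    {w : TB E M} (hw : w ∈ slit E M) (hne : (lam + aFun S P) w ≠ 0)
    (he : jacobiModel S w (X w) = lam w • X w) :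
    jacobiModel (projChange S P) w (shift S P (lam + aFun S P) X w)
      = (lam + aFun S P) w • shift S P (lam + aFun S P) X w := by
  rw [shift, map_add, map_smul, hS.jacobiModel_projChange_canonModel hP hw, smul_zero, add_zero,
    jacobiModel_projChange hS hP hw, he, smul_add, smul_smul, mul_div_cancel₀ _ hne, Pi.add_apply,
    add_smul]

variable [FiniteDimensional ℝ E]

lemma eigenvector_of_projChange (hS : IsSpray S) (hP : IsProjectiveFactor P)
    (hUs : U ⊆ slit E M) (hd : DiagModelOn U S) {lam : TB E M → ℝ} {w : TB E M} (hw : w ∈ U)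
    (hne : (lam + aFun S P) w ≠ 0) {y : E}
    (hy : jacobiModel (projChange S P) w
        (jacobiModel (projChange S P) w y - (lam + aFun S P) w • y)
      = (lam + aFun S P) w • (jacobiModel (projChange S P) w y - (lam + aFun S P) w • y)) :
    jacobiModel (projChange S P) w y = (lam + aFun S P) w • y :=
  eq_zero_of_perturbed_eigenvector (A := (jacobiModel S w : E →ₗ[ℝ] E))
    (B := (jacobiModel (projChange S P) w : E →ₗ[ℝ] E)) (b := bModel S P w) (t := canonModel w)
    (a := aFun S P w) (l := lam w) (hd w hw) (jacobiModel_projChange hS hP (hUs hw))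
    (hS.jacobiModel_canonModel (hUs hw)) (hS.jacobiModel_projChange_canonModel hP (hUs hw)) hne hy

/-- The bracket is `Φ̃ - λ̃` applied to the defect, and the defect is itself in the range of `Φ̃ -
λ̃`; without generalized eigenvectors it vanishes as soon as its image does. -/
lemma bracketModel_eq_zero_iff (hS : IsSpray S) (hP : IsProjectiveFactor P) (hU : IsOpen U)
    (hUs : U ⊆ slit E M) (hd : DiagModelOn U S) {lam : TB E M → ℝ}
    (hl : ContMDiffOn 𝓘(ℝ, E).tangent 𝓘(ℝ, ℝ) ∞ (lam + aFun S P) U)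
    (hne : ∀ v ∈ U, (lam + aFun S P) v ≠ 0) (hX : SmoothAlong U X)
    (he : ∀ v ∈ U, jacobiModel (projChange S P) v (X v) = (lam + aFun S P) v • X v)
    {w : TB E M} (hw : w ∈ U) :
    bracketModel (projChange S P) X w = 0
      ↔ defect (projChange S P) (lam + aFun S P) X w = 0 := by
  rw [bracketModel_eq (hS.isSode.projChange hP) hU hUs hl hX he hw]
  refine ⟨fun h => ?_, fun h => by rw [h, map_zero, smul_zero, sub_zero]⟩
  exact sub_eq_zero.2 (eigenvector_of_projChange hS hP hUs hd hw (hne w hw) (sub_eq_zero.1 h))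

/-- In `∇̃X` the operator `Φ̃ - λ̃` kills `P X` and also `∂_Δ X`, which is an eigenvector by
homogeneity; on `d^VP(X) T` it acts as `-λ̃`. -/
lemma defect_projChange (hS : IsSpray S) (hP : IsProjectiveFactor P) (hU : IsOpen U)
    (hUs : U ⊆ slit E M) (hd : DiagModelOn U S) {lam : TB E M → ℝ}
    (hl : ContMDiffOn 𝓘(ℝ, E).tangent 𝓘(ℝ, ℝ) ∞ (lam + aFun S P) U)
    (hne : ∀ v ∈ U, (lam + aFun S P) v ≠ 0) (hX : SmoothAlong U X)
    (he : ∀ v ∈ U, jacobiModel (projChange S P) v (X v) = (lam + aFun S P) v • X v)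
    {w : TB E M} (hw : w ∈ U) :
    defect (projChange S P) (lam + aFun S P) X w
      = jacobiModel (projChange S P) w (nablaModel S X w)
        - (lam + aFun S P) w • nablaModel S X w
        - ((lam + aFun S P) w * dVModel P w (X w)) • canonModel w := by
  obtain ⟨c, hc⟩ := exists_jacobiModel_vertD (hS.isSode.projChange hP) hU hUs hw
    (hS.quadraticAt_projChange hP (hUs hw) (mem_natChart_source_self w)) hX
    (differentiableAt_rep hU hl hw) he
  have hv := eigenvector_of_projChange hS hP hUs hd hw (hne w hw) (y := vertD X w)
    (by rw [hc, map_smul, he w hw, smul_comm])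
  rw [defect, nablaModel_projChange hS.isSode hP (hUs hw) (differentiableAt_compt hU hX hw)]
  simp only [map_add, map_sub, map_smul, hv, he w hw,
    hS.jacobiModel_projChange_canonModel hP (hUs hw)]
  module

/-- With `c = b(X)/λ̃`, `∇T = 0` gives `∇(X + cT) = ∇X + S(c)T`, and `S(c)` is eliminated by
differentiating `b(X) = λ̃c`. The term `P b(X)` comes from `d^VP(T) = P`. -/
lemma defect_shift (hS : IsSpray S) (hP : IsProjectiveFactor P) (hU : IsOpen U)
    (hUs : U ⊆ slit E M) (hd : DiagModelOn U S) {lam : TB E M → ℝ}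
    (hl : ContMDiffOn 𝓘(ℝ, E).tangent 𝓘(ℝ, ℝ) ∞ (lam + aFun S P) U)
    (hne : ∀ v ∈ U, (lam + aFun S P) v ≠ 0) (hX : SmoothAlong U X)
    (he : ∀ v ∈ U, jacobiModel S v (X v) = lam v • X v)
    {w : TB E M} (hw : w ∈ U) :
    defect (projChange S P) (lam + aFun S P) (shift S P (lam + aFun S P) X) w
      = jacobiModel S w (nablaModel S X w) - lam w • nablaModel S X w
        - ((lieD S (fun v => bModel S P v (X v)) w - bModel S P w (nablaModel S X w))
          + (-(lieD S (lam + aFun S P) w / (lam + aFun S P) w) + P w) * bModel S P w (X w)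
          + (lam + aFun S P) w * dVModel P w (X w)) • canonModel w := by
  have hS' := hS.isSode
  have hfst := hS'.fst w (hUs hw)
  have hlw := hne w hw
  have hc := smooth_shift_coeff hS hP hU hUs hl hne hX
  have hT : SmoothAlong U (canonModel : TB E M → E) := smoothAlong_canonModel
  have hcT := SmoothAlong.smul hU hT hc
  rw [defect_projChange hS hP hU hUs hd hl hne (smoothAlong_shift hS hP hU hUs hl hne hX)
    (fun v hv => jacobiModel_shift hS hP (hUs hv) (hne v hv) (he v hv)) hw]
  have hn : nablaModel S (shift S P (lam + aFun S P) X) w = nablaModel S X w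
      + lieD S (fun v => bModel S P v (X v) / (lam + aFun S P) v) w • canonModel w := by
    have h1 := nablaModel_add hfst (differentiableAt_compt hU hX hw)
      (differentiableAt_compt hU hcT hw)
    rw [nablaModel_smul hfst (differentiableAt_rep hU hc hw) (differentiableAt_compt hU hT hw)] at h1
    have h2 : nablaModel S canonModel w = 0 :=
      nablaModel_snd hS' (hUs hw) (hS.quadraticAt (hUs hw) (mem_natChart_source_self w))
    rw [h2, smul_zero, add_zero] at h1
    exact h1
  have hb : lieD S (fun v => bModel S P v (X v)) w
      = lieD S (lam + aFun S P) w * (bModel S P w (X w) / (lam + aFun S P) w)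
        + (lam + aFun S P) w
          * lieD S (fun v => bModel S P v (X v) / (lam + aFun S P) v) w := by
    rw [← lieD_mul hfst (differentiableAt_rep hU hl hw) (differentiableAt_rep hU hc hw)]
    refine lieD_congr hfst (differentiableAt_rep hU
      (smooth_bModel hS hP hU hUs (smooth_aFun hS' hP hUs) hX) hw) ?_
    filter_upwards [hU.mem_nhds hw] with v hv
    rw [mul_div_cancel₀ _ (hne v hv)]
  rw [hn, hb, shift, map_add (dVModel P w), map_smul (dVModel P w), dVModel_canonModel hP (hUs hw),
    map_add, map_smul, hS.jacobiModel_projChange_canonModel hP (hUs hw),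
    jacobiModel_projChange hS hP (hUs hw)]
  set x := lieD S (fun v => bModel S P v (X v) / (lam + aFun S P) v) w
  set d := lieD S (lam + aFun S P) w
  have hla : lam w = (lam + aFun S P) w - aFun S P w := by rw [Pi.add_apply]; ring
  rw [hla, smul_eq_mul]
  set L := (lam + aFun S P) w
  match_scalars <;> field_simp <;> ring

end Eigenfields

/-! ### Bump functions on `TM`. -/

section Localization

variable {E : Type*} [NormedAddCommGroup E] [NormedSpace ℝ E]
  {M : Type*} [TopologicalSpace M] [ChartedSpace E M] [IsManifold 𝓘(ℝ, E) ∞ M]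

/-- Vectors over different points are separated by the projection, vectors over the same point by a
common natural chart. -/
lemma t2Space_tangentBundle [T2Space M] : T2Space (TB E M) := by
  refine ⟨fun w w' hne => ?_⟩
  by_cases h : w.proj = w'.proj
  · have h0 := mem_natChart_source_self w
    have h0' : w' ∈ (natChart w.proj).source :=
      mem_natChart_source.2 (h ▸ mem_chart_source E w.proj)
    obtain ⟨A, B, hA, hB, hwA, hwB, hAB⟩ :=
      t2_separation (fun he => hne ((natChart w.proj).injOn h0 h0' he))
    have hc : ContinuousOn (natChart (E := E) w.proj) (natChart w.proj).source :=
      continuousOn_extChartAt _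
    exact ⟨_, _, hc.isOpen_inter_preimage (isOpen_natChart_source _) hA,
      hc.isOpen_inter_preimage (isOpen_natChart_source _) hB, ⟨h0, hwA⟩, ⟨h0', hwB⟩,
      Set.disjoint_left.2 fun x hx hx' => Set.disjoint_left.1 hAB hx.2 hx'.2⟩
  · obtain ⟨A, B, hA, hB, hwA, hwB, hAB⟩ := t2_separation h
    have hc : Continuous (fun w : TB E M => w.proj) :=
      FiberBundle.continuous_proj E (TangentSpace 𝓘(ℝ, E))
    exact ⟨_, _, hA.preimage hc, hB.preimage hc, hwA, hwB, hAB.preimage _⟩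

lemma exists_smooth_support_subset [FiniteDimensional ℝ E] [T2Space M] {W : Set (TB E M)}
    {w : TB E M} (hW : W ∈ 𝓝 w) : ∃ g : TB E M → ℝ, ContMDiff 𝓘(ℝ, E).tangent 𝓘(ℝ, ℝ) ∞ g ∧
      g w = 1 ∧ ∀ v ∉ W, g v = 0 := by
  have := t2Space_tangentBundle (E := E) (M := M)
  obtain ⟨f, -, hf⟩ := (SmoothBumpFunction.nhds_basis_tsupport
    (I := 𝓘(ℝ, E).tangent) w).mem_iff.1 hW
  exact ⟨f, f.contMDiff, f.eq_one, fun v hv => image_eq_zero_of_notMem_tsupport fun h => hv (hf h)⟩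

end Localization

/-! ### From shifted eigenfields to all eigenfields, and the equivalence. -/

section Main

variable {E : Type*} [NormedAddCommGroup E] [NormedSpace ℝ E] [FiniteDimensional ℝ E]
  {M : Type*} [TopologicalSpace M] [ChartedSpace E M] [IsManifold 𝓘(ℝ, E) ∞ M]
  {S : FieldOn E M} {P lam : TB E M → ℝ} {U : Set (TB E M)}

/-- If the shifts of all eigenfields of `Φ` have vanishing defect, then so do all eigenfields of the
projectively changed Jacobi endomorphism. -/
lemma defect_eq_zero_of_shift [T2Space M] (hS : IsSpray S) (hP : IsProjectiveFactor P)
    (hU : IsOpen U) (hUs : U ⊆ slit E M) (hd : DiagModelOn U S)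
    (hl : ContMDiffOn 𝓘(ℝ, E).tangent 𝓘(ℝ, ℝ) ∞ (lam + aFun S P) U)
    (hne : ∀ v ∈ U, (lam + aFun S P) v ≠ 0)
    (H : ∀ X : TB E M → E, SmoothAlong U X → (∀ v ∈ U, jacobiModel S v (X v) = lam v • X v) →
      ∀ v ∈ U, defect (projChange S P) (lam + aFun S P) (shift S P (lam + aFun S P) X) v = 0)
    {X : TB E M → E} (hX : SmoothAlong U X)
    (he : ∀ v ∈ U, jacobiModel (projChange S P) v (X v) = (lam + aFun S P) v • X v)
    {w : TB E M} (hw : w ∈ U) : defect (projChange S P) (lam + aFun S P) X w = 0 := by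
  have hS' := hS.isSode
  have hT := hS'.projChange hP
  have ha := smooth_aFun hS' hP hUs
  have hlam : ContMDiffOn 𝓘(ℝ, E).tangent 𝓘(ℝ, ℝ) ∞ lam U := by
    have := hl.sub ha
    simpa only [Pi.add_apply, add_sub_cancel_right] using this
  have hb := smooth_bModel hS hP hU hUs ha hX
  have hJ : ∀ v ∈ U, jacobiModel S v (X v) + bModel S P v (X v) • canonModel v = lam v • X v := by
    intro v hv
    have := he v hv
    rw [jacobiModel_projChange hS hP (hUs hv), Pi.add_apply, add_smul, add_right_comm] at this
    exact add_right_cancel this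
  have hoff : ∀ v ∈ {v ∈ U | lam v ≠ 0}, defect (projChange S P) (lam + aFun S P) X v = 0 := by
    rintro v ⟨hv, hv0⟩
    have hlX := SmoothAlong.smul hU hX hlam
    -- By `hJ` this field is `Φ(X)`, so `Φ(T) = 0` makes it a `λ`-eigenfield. As `b(T) = -a`, `b`
    -- takes the value `λ̃ b(X)` on it and its shift is `λX`.
    have hY : SmoothAlong U (fun v => lam v • X v + (-bModel S P v (X v)) • canonModel v) :=
      SmoothAlong.add_smul hU hlX smoothAlong_canonModel hb.neg
    have hbY : ∀ u ∈ U, bModel S P u (lam u • X u + (-bModel S P u (X u)) • canonModel u)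
        = (lam + aFun S P) u * bModel S P u (X u) := by
      intro u hu
      rw [map_add, map_smul, map_smul, bModel_canonModel hS hP (hUs hu), Pi.add_apply]
      simp only [smul_eq_mul]
      ring
    have h1 := H _ hY (fun u hu => by
      have h2 := hJ u hu
      rw [map_add, map_smul, map_smul, hS.jacobiModel_canonModel (hUs hu), smul_zero, add_zero,
        eq_sub_of_add_eq h2, neg_smul, sub_eq_add_neg]) v hv
    rw [defect_congr hT hU hUs (smoothAlong_shift hS hP hU hUs hl hne hY) hv
      (Y := fun v => lam v • X v) (fun u hu => by
        rw [shift, hbY u hu, mul_div_cancel_left₀ _ (hne u hu)]; module),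
      defect_smul hT hU hUs hX hlam hv (he v hv)] at h1
    exact (smul_eq_zero.1 h1).resolve_left hv0
  by_cases hcl : w ∈ closure {v ∈ U | lam v ≠ 0}
  · exact SmoothAlong.eq_zero_of_mem_closure hU (smoothAlong_defect hT hU hUs hl hX) hoff hw hcl
  -- Here `λ` vanishes on `U` near `w`; the cutoff makes `gX` a `λ`-eigenfield on all of `U`, with
  -- shift `gX`, without changing the defect at `w`.
  · obtain ⟨g, hg, hgw, hgW⟩ := exists_smooth_support_subset
      (isClosed_closure.isOpen_compl.mem_nhds hcl)
    have hgX := SmoothAlong.smul hU hX hg.contMDiffOn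
    have hz : ∀ v ∈ U, g v = 0 ∨ lam v = 0 := by
      intro v hv
      by_contra! h
      refine h.1 (hgW v fun hv' => hv' (subset_closure ⟨hv, h.2⟩))
    have hk : ∀ v ∈ U, jacobiModel S v (g v • X v) = 0 ∧ bModel S P v (g v • X v) = 0 := by
      intro v hv
      rcases hz v hv with h | h
      · rw [h, zero_smul, map_zero, map_zero]; exact ⟨rfl, rfl⟩
      · have h1 := hJ v hv
        rw [h, zero_smul] at h1
        have h2 := apply_eq_zero_of_perturbed_kernel (A := (jacobiModel S v : E →ₗ[ℝ] E))
          (b := bModel S P v) (hd v hv) (hS.jacobiModel_canonModel (hUs hv)) (hUs hv) h1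
        have h3 : jacobiModel S v (X v) = 0 := h2.1
        rw [map_smul, map_smul, h3, h2.2, smul_zero, smul_zero]
        exact ⟨rfl, rfl⟩
    have h1 := H _ hgX (fun v hv => by
      rw [(hk v hv).1]
      rcases hz v hv with h | h <;> rw [h, zero_smul]
      rw [smul_zero]) w hw
    rw [defect_congr hT hU hUs (smoothAlong_shift hS hP hU hUs hl hne hgX) hw
      (Y := fun v => g v • X v) (fun u hu => by
        rw [shift, (hk u hu).2, zero_div, zero_smul, add_zero]),
      defect_smul hT hU hUs hX hg.contMDiffOn hw (he w hw), hgw, one_smul] at h1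
    exact h1

end Main

end SprayGeom

end

theorem proposition4p2
    {E : Type*} [NormedAddCommGroup E] [NormedSpace ℝ E] [FiniteDimensional ℝ E]
    {M : Type*} [TopologicalSpace M] [T2Space M] [ChartedSpace E M] [IsManifold 𝓘(ℝ, E) ∞ M]
    (S : SprayGeom.FieldOn E M) (hS : SprayGeom.IsSpray S)
    (P : SprayGeom.TB E M → ℝ) (hP : SprayGeom.IsProjectiveFactor P)
    (U : Set (SprayGeom.TB E M)) (hU : IsOpen U) (hUslit : U ⊆ SprayGeom.slit E M)
    (hdiag : SprayGeom.DiagonalizableOn U (SprayGeom.jacobi S))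
    (lam : SprayGeom.TB E M → ℝ)
    (hlam : SprayGeom.IsEigenfunctionOn U (SprayGeom.jacobi (SprayGeom.projChange S P))
      (lam + SprayGeom.aFun S P))
    (hne : ∀ v ∈ U, (lam + SprayGeom.aFun S P) v ≠ 0) :
    (∀ X ∈ SprayGeom.eigenDist U (SprayGeom.jacobi (SprayGeom.projChange S P))
        (lam + SprayGeom.aFun S P),
      ∀ v ∈ U, SprayGeom.bracketNablaJacobi (SprayGeom.projChange S P) X v = 0) ↔
    (∀ X ∈ SprayGeom.eigenDist U (SprayGeom.jacobi S) lam, ∀ v ∈ U,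
      SprayGeom.jacobi S v (SprayGeom.nabla S X v) - lam v • SprayGeom.nabla S X v =
        (SprayGeom.nablaForm S (SprayGeom.bForm S P) X v
          + (-(SprayGeom.lieD S (lam + SprayGeom.aFun S P) v / (lam + SprayGeom.aFun S P) v)
              + P v) * SprayGeom.bForm S P v (X v)
          + (lam + SprayGeom.aFun S P) v * SprayGeom.dV P v (X v)) • SprayGeom.T v) := by
  -- The model versions are definitionally the original objects with each tangent space read as `E`,
  -- so statements transfer without proof.
  have hd : SprayGeom.DiagModelOn U S := hdiag
  have hl := hlam.smooth
  have hT := hS.isSode.projChange hP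
  constructor
  · intro H X hX v hv
    have he : ∀ v ∈ U, SprayGeom.jacobiModel S v (X v) = lam v • X v := hX.2
    have hY := SprayGeom.smoothAlong_shift hS hP hU hUslit hl hne hX.1
    have heY : ∀ v ∈ U, SprayGeom.jacobiModel (SprayGeom.projChange S P) v (SprayGeom.shift S P (lam + SprayGeom.aFun S P) X v)
        = (lam + SprayGeom.aFun S P) v • SprayGeom.shift S P (lam + SprayGeom.aFun S P) X v :=
      fun v hv => SprayGeom.jacobiModel_shift hS hP (hUslit hv) (hne v hv) (he v hv)
    have h1 := (SprayGeom.bracketModel_eq_zero_iff hS hP hU hUslit hd hl hne hY heY hv).1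
      (H _ ⟨hY, heY⟩ v hv)
    rw [SprayGeom.defect_shift hS hP hU hUslit hd hl hne hX.1 he hv] at h1
    exact sub_eq_zero.1 h1
  · intro H X hX v hv
    refine (SprayGeom.bracketModel_eq_zero_iff hS hP hU hUslit hd hl hne hX.1 hX.2 hv).2 ?_
    refine SprayGeom.defect_eq_zero_of_shift hS hP hU hUslit hd hl hne (fun Y hY he w hw => ?_) hX.1 hX.2 hv
    rw [SprayGeom.defect_shift hS hP hU hUslit hd hl hne hY he hw]
    exact sub_eq_zero.2 (H Y ⟨hY, he⟩ w hw)
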